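/- **Setting.** Let $q\in\mathbb C$ be nonzero and not a root of unity, put $p^{1/2}=iq$ (so $p=-q^2$), and let $x$ be an indeterminate. Let $V=\mathbb Cv_0\oplus\mathbb Cv_1$ and $\boldsymbol V=V^{\otimes n}$ with basis $v_{\boldsymbol\alpha}=v_{\alpha_1}\otimes\cdots\otimes v_{\alpha_n}$, $\boldsymbol\alpha\in\{0,1\}^n$, and let $\boldsymbol V_\pm$ be the span of the $v_{\boldsymbol\alpha}$ with $(-1)^{\alpha_1+\cdots+\alpha_n}=\pm1$. **The matrices $\mathscr R^{s,t}(x)$.** Let $\mathcal A$ be the algebra generated by $\mathbf a^+,\mathbf a^-,\mathbf k$ with relations $\mathbf k\mathbf a^\pm=p^{\pm1}\mathbf a^\pm\mathbf k$, $\mathbf a^+\mathbf a^-=1-p^{-1}\mathbf k^2$, $\mathbf a^-\mathbf a^+=1-p\,\mathbf k^2$, acting on the Fock space $F=\bigoplus_{m\ge0}\mathbb C|m\rangle$ (and on its completion $\prod_{m}\mathbb C|m\rangle$) by $\mathbf a^+|m\rangle=\sqrt{1-p^{2m+2}}\,|m+1\rangle$, $\mathbf a^-|m\rangle=\sqrt{1-p^{2m}}\,|m-1\rangle$,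 $\mathbf k|m\rangle=p^{m+1/2}|m\rangle$, with $\langle m|m'\rangle=\delta_{mm'}$. For $s,t\in\{1,2\}$ let $$|\chi_t(1)\rangle=\frac1{((\mathbf a^+)^t;p^{t^2})_\infty}|0\rangle,\qquad \langle\overline\chi_s(x)|=\langle0|\frac1{(x(\mathbf a^-)^s;p^{s^2})_\infty},$$ where $1/(z;b)_\infty$, the inverse of $\prod_{i\ge0}(1-zb^i)$, stands for its expansion $\sum_{j\ge0}z^j/\prod_{i=1}^j(1-b^i)$. Thus $\langle\overline\chi_s(x)|\mathcal O|\chi_t(1)\rangle\in\mathbb C[[x]]$ for $\mathcal O\in\mathcal A$. Put $$\langle\mathcal O\rangle_{s1}=\frac{\langle\overline\chi_s(x)|\mathcal O|\chi_1(1)\rangle}{\langle\overline\chi_s(x)|\chi_1(1)\rangle}\quad(s=1,2).$$ Let $\langle\,\cdot\,\rangle_{22}$ be the linear form equal to $\dfrac{\langle\overline\chi_2(x)|\mathcal O|\chi_2(1)\rangle}{\langle\overline\chi_2(x)|\chi_2(1)\rangle}$ if $\mathcal O$ is even in $\mathbf a^\pm$ and even in $\mathbf k$, to $\dfrac{\langle\overline\chi_2(x)|\mathcal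 O|\chi_2(1)\rangle}{\langle\overline\chi_2(x)|(-i\mathbf k)|\chi_2(1)\rangle}$ if $\mathcal O$ is even in $\mathbf a^\pm$ and odd in $\mathbf k$, and to $0$ if $\mathcal O$ is odd in $\mathbf a^\pm$ (parity refers to the automorphisms $\mathbf a^\pm\mapsto-\mathbf a^\pm$, $\mathbf k\mapsto \mathbf k$ and $\mathbf a^\pm\mapsto\mathbf a^\pm$, $\mathbf k\mapsto-\mathbf k$). Let $\mathscr L(\alpha',\beta'|\alpha,\beta)\in\mathcal A$ be given by $\mathscr L(0,0|0,0)=\mathscr L(1,1|1,1)=1$, $\mathscr L(1,0|1,0)=\mathscr L(0,1|0,1)=-i\mathbf k$, $\mathscr L(1,0|0,1)=\mathbf a^+$, $\mathscr L(0,1|1,0)=\mathbf a^-$, all other entries being $0$. For $(s,t)=(2,1),(1,1),(2,2)$ define the $n$-layer matrix $$\mathscr R^{s,t}(x)(v_{\boldsymbol\alpha}\otimes v_{\boldsymbol\beta})=\sum_{\boldsymbol\alpha',\boldsymbol\beta'}\big\langle\mathscr L(\alpha_1',\beta_1'|\alpha_1,\beta_1)\cdots\mathscr L(\alpha_n',\beta_n'|\alpha_n,\beta_n)\big\rangle_{st}\,v_{\boldsymbol\alpha'}\otimes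 v_{\boldsymbol\beta'} .$$ **Quantum $R$ matrices.** On $V$ let $X^+v_0=0$, $X^+v_1=v_0$, $X^-v_0=v_1$, $X^-v_1=0$, $Hv_0=\frac12v_0$, $Hv_1=-\frac12v_1$. A subscript $j$ in parentheses denotes action on the $j$-th tensor factor of $\boldsymbol V$. The spin representation is given on $\boldsymbol V$ by the following operators. * For $1\le i<n$: $X_i^+=-X^+_{(i)}X^-_{(i+1)}$ and $H_i=H_{(i)}-H_{(i+1)}$. * For $i=n$: $X_n^+=(q+q^{-1})^{-1/2}X^+_{(n)}$, $H_n=H_{(n)}$ for $B^{(1)}_n$ and $D^{(2)}_{n+1}$; $X_n^+=-X^+_{(n-1)}X^+_{(n)}$, $H_n=H_{(n-1)}+H_{(n)}$ for $D^{(1)}_n$. * For $i=0$: $X_0^+=-X^-_{(1)}X^-_{(2)}$, $H_0=-H_{(1)}-H_{(2)}$ for $B^{(1)}_n$ and $D^{(1)}_n$; $X_0^+=-(q+q^{-1})^{-1/2}X^-_{(1)}$, $H_0=-H_{(1)}$ for $D^{(2)}_{n+1}$. * $X_i^-$ is the transpose of $X_i^+$. The normalized quantum $R$ matrix $R(x)$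 of the spin representation is the matrix over $\mathbb C(x)$ acting on $\boldsymbol V\otimes\boldsymbol V$ such that $\check R(x)=PR(x)$, where $P(u\otimes v)=v\otimes u$, commutes, for $1\le i\le n$, with $q^{H_i}\otimes X_i^\pm+X_i^\pm\otimes q^{-H_i}$ and with $H_i\otimes1+1\otimes H_i$, satisfies $$\check R(x)(q^{H_0}\otimes X_0^++x\,X_0^+\otimes q^{-H_0})=(x\,q^{H_0}\otimes X_0^++X_0^+\otimes q^{-H_0})\check R(x),$$ and is normalized as follows. For $B^{(1)}_n$ and $D^{(2)}_{n+1}$, the diagonal entry of $R(x)$ at $v_{0,\ldots,0}\otimes v_{0,\ldots,0}$ is $1$. For $D^{(1)}_n$, $R(x)$ maps each $\boldsymbol V_\varepsilon\otimes\boldsymbol V_{\varepsilon'}$ ($\varepsilon,\varepsilon'=\pm$) into itself, and its diagonal entry at $v_{0,\ldots,0,\alpha}\otimes v_{0,\ldots,0,\beta}$ is $1$ for all $\alpha,\beta\in\{0,1\}$. **Theorem 6.1.** The normalized quantum $R$ matrices $R_{B^{(1)}_n}(x)$ ($n\ge2$), $R_{D^{(2)}_{n+1}}(x)$ ($n\ge1$)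 and $R_{D^{(1)}_n}(x)$ ($n\ge3$) exist and are unique, and $$\mathscr R^{2,1}(x)=R_{B^{(1)}_n}(x),\qquad \mathscr R^{1,1}(x)=R_{D^{(2)}_{n+1}}(x),\qquad \mathscr R^{2,2}(x)=R_{D^{(1)}_n}(x),$$ that is, the entries on the left are the expansions at $x=0$ of the rational functions on the right. -/

import Mathlib

open scoped Kronecker

namespace SpinR

noncomputable section

/-! ## The oscillator algebra

Throughout the bosonic part, `h` denotes `p^{1/2}`, so that `p = h ^ 2`. -/

/-- The generators `a⁺, a⁻, k`. -/
inductive OscGen : Type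
  | ap : OscGen
  | am : OscGen
  | kk : OscGen

/-- The generators inside the free algebra. -/
def gen (g : OscGen) : FreeAlgebra ℂ OscGen := FreeAlgebra.ι ℂ g

/-- The defining relations `k a^± = p^{±1} a^± k`, `a⁺ a⁻ = 1 - p⁻¹ k²`, `a⁻ a⁺ = 1 - p k²`. -/
inductive OscRel (p : ℂ) : FreeAlgebra ℂ OscGen → FreeAlgebra ℂ OscGen → Prop
  | k_ap : OscRel p (gen .kk * gen .ap) (p • (gen .ap * gen .kk))
  | k_am : OscRel p (gen .kk * gen .am) (p⁻¹ • (gen .am * gen .kk))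
  | ap_am : OscRel p (gen .ap * gen .am) (1 - p⁻¹ • gen .kk ^ 2)
  | am_ap : OscRel p (gen .am * gen .ap) (1 - p • gen .kk ^ 2)

/-- The oscillator algebra `𝒜` with parameter `p`. -/
def Osc (p : ℂ) : Type := RingQuot (OscRel p)

instance (p : ℂ) : Ring (Osc p) := inferInstanceAs (Ring (RingQuot (OscRel p)))

instance (p : ℂ) : Algebra ℂ (Osc p) := inferInstanceAs (Algebra ℂ (RingQuot (OscRel p)))

/-- The quotient map from the free algebra. -/
def oscMk (p : ℂ) : FreeAlgebra ℂ OscGen →ₐ[ℂ] Osc p := RingQuot.mkAlgHom ℂ (OscRel p)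

theorem oscMk_rel {p : ℂ} {x y : FreeAlgebra ℂ OscGen} (hxy : OscRel p x y) :
    oscMk p x = oscMk p y :=
  RingQuot.mkAlgHom_rel ℂ hxy

/-- A generator of the oscillator algebra. -/
def osc (p : ℂ) (g : OscGen) : Osc p := oscMk p (gen g)

/-- Algebra homomorphisms out of `𝒜`, given by images of generators that satisfy the relations. -/
def oscLift {p : ℂ} {B : Type} [Ring B] [Algebra ℂ B] (f : OscGen → B)
    (h₁ : f .kk * f .ap = p • (f .ap * f .kk)) (h₂ : f .kk * f .am = p⁻¹ • (f .am * f .kk))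
    (h₃ : f .ap * f .am = 1 - p⁻¹ • f .kk ^ 2) (h₄ : f .am * f .ap = 1 - p • f .kk ^ 2) :
    Osc p →ₐ[ℂ] B :=
  RingQuot.liftAlgHom ℂ ⟨FreeAlgebra.lift ℂ f, by
    intro x y hxy
    cases hxy <;> simp [gen, h₁, h₂, h₃, h₄]⟩

theorem oscLift_osc {p : ℂ} {B : Type} [Ring B] [Algebra ℂ B] (f : OscGen → B)
    (h₁ : f .kk * f .ap = p • (f .ap * f .kk)) (h₂ : f .kk * f .am = p⁻¹ • (f .am * f .kk))
    (h₃ : f .ap * f .am = 1 - p⁻¹ • f .kk ^ 2) (h₄ : f .am * f .ap = 1 - p • f .kk ^ 2)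
    (g : OscGen) : oscLift f h₁ h₂ h₃ h₄ (osc p g) = f g := by
  have key := RingQuot.liftAlgHom_mkAlgHom_apply ℂ (s := OscRel p) (FreeAlgebra.lift ℂ f)
    (by
      intro x y hxy
      cases hxy <;> simp [gen, h₁, h₂, h₃, h₄]) (gen g)
  exact key.trans (FreeAlgebra.lift_ι_apply f g)

theorem osc_k_ap (p : ℂ) : osc p .kk * osc p .ap = p • (osc p .ap * osc p .kk) := by
  simpa [osc] using oscMk_rel (OscRel.k_ap (p := p))

theorem osc_k_am (p : ℂ) : osc p .kk * osc p .am = p⁻¹ • (osc p .am * osc p .kk) := by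
  simpa [osc] using oscMk_rel (OscRel.k_am (p := p))

theorem osc_ap_am (p : ℂ) : osc p .ap * osc p .am = 1 - p⁻¹ • osc p .kk ^ 2 := by
  simpa [osc] using oscMk_rel (OscRel.ap_am (p := p))

theorem osc_am_ap (p : ℂ) : osc p .am * osc p .ap = 1 - p • osc p .kk ^ 2 := by
  simpa [osc] using oscMk_rel (OscRel.am_ap (p := p))

/-- The involution `σ₁`: `a^± ↦ -a^±`, `k ↦ k`. -/
def sigma₁ (p : ℂ) : Osc p →ₐ[ℂ] Osc p :=
  oscLift (fun g => match g with
      | .ap => -osc p .ap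
      | .am => -osc p .am
      | .kk => osc p .kk)
    (by simp [osc_k_ap]) (by simp [osc_k_am]) (by simp [osc_ap_am]) (by simp [osc_am_ap])

/-- The involution `σ₂`: `a^± ↦ a^±`, `k ↦ -k`. -/
def sigma₂ (p : ℂ) : Osc p →ₐ[ℂ] Osc p :=
  oscLift (fun g => match g with
      | .ap => osc p .ap
      | .am => osc p .am
      | .kk => -osc p .kk)
    (by simp [osc_k_ap]) (by simp [osc_k_am]) (by simp [osc_ap_am]) (by simp [osc_am_ap])

/-- The projection of `𝒜 = 𝒜₊₊ ⊕ 𝒜₊₋ ⊕ 𝒜₋₊ ⊕ 𝒜₋₋` onto the joint eigenspace `𝒜_{ε₁, ε₂}`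
(`σᵢ = εᵢ`), for signs `ε₁, ε₂ = ±1`. -/
def proj (p ε₁ ε₂ : ℂ) (O : Osc p) : Osc p :=
  (1 / 4 : ℂ) • (O + ε₁ • sigma₁ p O + ε₂ • sigma₂ p O + (ε₁ * ε₂) • sigma₁ p (sigma₂ p O))

/-! ## The Fock representation

The boundary vectors are infinite sums of the basis vectors `|m⟩`, hence live in the completion
`∏ₘ ℂ|m⟩` of the Fock space `⨁ₘ ℂ|m⟩`.  A vector `∑ₘ f m |m⟩` of the completion is the
function `f : ℕ → ℂ`, and `⟨m|` is the evaluation at `m`. -/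

/-- A square root of a complex number. -/
def csqrt (z : ℂ) : ℂ := z ^ (2⁻¹ : ℂ)

theorem csqrt_mul_self (z : ℂ) : csqrt z * csqrt z = z := by
  rw [← pow_two]
  exact_mod_cast Complex.cpow_nat_inv_pow z two_ne_zero

/-- `a⁺|m⟩ = √(1 - p^{2m+2}) |m+1⟩`. -/
def fockAp (h : ℂ) : Module.End ℂ (ℕ → ℂ) where
  toFun f := fun m => match m with
    | 0 => 0
    | m + 1 => csqrt (1 - (h ^ 2) ^ (2 * m + 2)) * f m
  map_add' f g := by
    funext m
    cases m <;> simp [mul_add]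
  map_smul' c f := by
    funext m
    cases m <;> simp [mul_left_comm]

/-- `a⁻|m⟩ = √(1 - p^{2m}) |m-1⟩`. -/
def fockAm (h : ℂ) : Module.End ℂ (ℕ → ℂ) where
  toFun f := fun m => csqrt (1 - (h ^ 2) ^ (2 * (m + 1))) * f (m + 1)
  map_add' f g := by
    funext m
    simp [mul_add]
  map_smul' c f := by
    funext m
    simp [mul_left_comm]

/-- `k|m⟩ = p^{m+1/2} |m⟩`. -/
def fockK (h : ℂ) : Module.End ℂ (ℕ → ℂ) where
  toFun f := fun m => h ^ (2 * m + 1) * f m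
  map_add' f g := by
    funext m
    simp [mul_add]
  map_smul' c f := by
    funext m
    simp [mul_left_comm]

/-- The Fock representation of the oscillator algebra. -/
def fock (h : ℂ) (hh : h ≠ 0) : Osc (h ^ 2) →ₐ[ℂ] Module.End ℂ (ℕ → ℂ) :=
  oscLift (fun g => match g with
      | .ap => fockAp h
      | .am => fockAm h
      | .kk => fockK h)
    (by
      ext f m
      rcases m with _ | m
      · simp [fockAp, fockK]
      · simp [fockAp, fockK]
        ring)
    (by
      ext f m
      simp [fockAm, fockK]
      field_simp
      ring)
    (by
      ext f m
      rcases m with _ | m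
      · simp [fockAp, fockAm, fockK, pow_two]
        field_simp
        simp
      · simp only [fockAp, fockAm, fockK, Module.End.mul_apply, LinearMap.coe_mk, AddHom.coe_mk,
          LinearMap.sub_apply, LinearMap.smul_apply, Module.End.one_apply, Pi.sub_apply,
          Pi.smul_apply, smul_eq_mul, pow_two (_ : Module.End ℂ (ℕ → ℂ))]
        rw [← mul_assoc, show 2 * m + 2 = 2 * (m + 1) by ring, csqrt_mul_self]
        field_simp
        ring)
    (by
      ext f m
      simp only [fockAp, fockAm, fockK, Module.End.mul_apply, LinearMap.coe_mk, AddHom.coe_mk,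
        LinearMap.sub_apply, LinearMap.smul_apply, Module.End.one_apply, Pi.sub_apply,
        Pi.smul_apply, smul_eq_mul, pow_two (_ : Module.End ℂ (ℕ → ℂ))]
      rw [← mul_assoc, show 2 * m + 2 = 2 * (m + 1) by ring, csqrt_mul_self]
      ring)

/-- The vacuum `|0⟩`. -/
def vac : ℕ → ℂ := Pi.single 0 1

/-! ## The boundary vectors -/

/-- The coefficient `1 / (b; b)_j` of `z ^ j` in the expansion of `1 / (z; b)_∞`. -/
def invQCoeff (b : ℂ) (j : ℕ) : ℂ := (∏ i ∈ Finset.range j, (1 - b ^ (i + 1)))⁻¹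

/-- `|χ_t(y)⟩ = 1 / (y (a⁺)^t; p^{t²})_∞ |0⟩`, for `t = 1, 2`.  The component along `|m⟩` of
the infinite sum over `j` only has the contribution `t j = m`; so `j ≤ m` suffices. -/
def ket (h : ℂ) (hh : h ≠ 0) (t : ℕ) (y : ℂ) : ℕ → ℂ := fun m =>
  ∑ j ∈ Finset.range (m + 1), invQCoeff ((h ^ 2) ^ (t ^ 2)) j * y ^ j *
    (fock h hh (osc (h ^ 2) .ap ^ (t * j)) vac) m

/-- `⟨χ̄_s(x)| O |χ_t(1)⟩` with `⟨χ̄_s(x)| = ⟨0| 1 / (x (a⁻)^s; p^{s²})_∞`, as a formal power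
series in the indeterminate `x`. -/
def sandwich (h : ℂ) (hh : h ≠ 0) (s t : ℕ) (O : Osc (h ^ 2)) : PowerSeries ℂ :=
  PowerSeries.mk fun j => invQCoeff ((h ^ 2) ^ (s ^ 2)) j *
    (fock h hh (osc (h ^ 2) .am ^ (s * j) * O) (ket h hh t 1)) 0

/-- The linear form `⟨O⟩_{s1}`, `s = 1, 2`. -/
def bracket₁ (h : ℂ) (hh : h ≠ 0) (s : ℕ) (O : Osc (h ^ 2)) : PowerSeries ℂ :=
  sandwich h hh s 1 O * (sandwich h hh s 1 1)⁻¹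

/-- The linear form `⟨O⟩_{22}`: it is `⟨χ̄₂(x)|O|χ₂(1)⟩ / ⟨χ̄₂(x)|χ₂(1)⟩` on `𝒜₊₊`,
`⟨χ̄₂(x)|O|χ₂(1)⟩ / ⟨χ̄₂(x)|(-ik)|χ₂(1)⟩` on `𝒜₊₋`, and zero on `𝒜₋₊` and `𝒜₋₋`. -/
def bracket₂₂ (h : ℂ) (hh : h ≠ 0) (O : Osc (h ^ 2)) : PowerSeries ℂ :=
  sandwich h hh 2 2 (proj (h ^ 2) 1 1 O) * (sandwich h hh 2 2 1)⁻¹ +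
    sandwich h hh 2 2 (proj (h ^ 2) 1 (-1) O) *
      (sandwich h hh 2 2 (-Complex.I • osc (h ^ 2) .kk))⁻¹

/-! ## The `L` operator and the matrices `𝓡^{s,t}(x)` -/

/-- The entries `ℒ(α', β' | α, β) ∈ 𝒜` of the `L` operator. -/
def Lop (p : ℂ) (α' β' α β : Fin 2) : Osc p :=
  if α' = α ∧ β' = β then (if α = β then 1 else -Complex.I • osc p .kk)
  else if α' = 1 ∧ β' = 0 ∧ α = 0 ∧ β = 1 then osc p .ap
  else if α' = 0 ∧ β' = 1 ∧ α = 1 ∧ β = 0 then osc p .am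
  else 0

/-- The labels `α = (α₁, …, α_n) ∈ {0,1}ⁿ` of the basis `v_α` of `𝐕 = (ℂ²)^{⊗n}`. -/
abbrev Lab (n : ℕ) : Type := Fin n → Fin 2

/-- The matrix, in the basis `v_α ⊗ v_β` of `𝐕 ⊗ 𝐕`, with the entries
`φ(ℒ(α'₁, β'₁ | α₁, β₁) ⋯ ℒ(α'_n, β'_n | α_n, β_n))` in row `(α', β')` and column `(α, β)`. -/
def layerR {p : ℂ} (n : ℕ) (φ : Osc p → PowerSeries ℂ) :
    Matrix (Lab n × Lab n) (Lab n × Lab n) (PowerSeries ℂ) :=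
  Matrix.of fun a' a =>
    φ (List.ofFn fun j : Fin n => Lop p (a'.1 j) (a'.2 j) (a.1 j) (a.2 j)).prod

/-- The three families of affine algebras `B^{(1)}_n`, `D^{(2)}_{n+1}`, `D^{(1)}_n`. -/
inductive AffineType : Type
  | B1 : AffineType
  | D2 : AffineType
  | D1 : AffineType

/-- `𝓡^{2,1}(x)`, `𝓡^{1,1}(x)` and `𝓡^{2,2}(x)` respectively, as matrices of power series
in `x`. -/
def calR (T : AffineType) (n : ℕ) (h : ℂ) (hh : h ≠ 0) :
    Matrix (Lab n × Lab n) (Lab n × Lab n) (PowerSeries ℂ) :=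
  match T with
  | .B1 => layerR n (bracket₁ h hh 2)
  | .D2 => layerR n (bracket₁ h hh 1)
  | .D1 => layerR n (bracket₂₂ h hh)

/-! ## Spin representations -/

/-- `X⁺ v₀ = 0`, `X⁺ v₁ = v₀`. -/
def Xp : Matrix (Fin 2) (Fin 2) ℂ := !![0, 1; 0, 0]

/-- `X⁻ v₀ = v₁`, `X⁻ v₁ = 0`. -/
def Xm : Matrix (Fin 2) (Fin 2) ℂ := !![0, 0; 1, 0]

/-- `H v₀ = v₀ / 2`, `H v₁ = - v₁ / 2`. -/
def Hm : Matrix (Fin 2) (Fin 2) ℂ := !![1 / 2, 0; 0, -(1 / 2)]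

/-- The operator `f 1 ⊗ f 2 ⊗ ⋯ ⊗ f n` on `𝐕 = (ℂ²)^{⊗n}`; tensor positions are numbered
from `1` to `n`. -/
def tens (n : ℕ) (f : ℕ → Matrix (Fin 2) (Fin 2) ℂ) : Matrix (Lab n) (Lab n) ℂ :=
  Matrix.of fun α' α => ∏ j : Fin n, f ((j : ℕ) + 1) (α' j) (α j)

/-- `M` acting on the tensor position `i`. -/
def site (n i : ℕ) (M : Matrix (Fin 2) (Fin 2) ℂ) : Matrix (Lab n) (Lab n) ℂ :=
  tens n fun j => if j = i then M else 1

/-- `M` and `N` acting on the tensor positions `i` and `i + 1`. -/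
def site₂ (n i : ℕ) (M N : Matrix (Fin 2) (Fin 2) ℂ) : Matrix (Lab n) (Lab n) ℂ :=
  tens n fun j => if j = i then M else if j = i + 1 then N else 1

/-- The action of the Chevalley generator `X⁺_i`, `0 ≤ i ≤ n`, in the spin representation. -/
def chevX (T : AffineType) (n : ℕ) (q : ℂ) (i : ℕ) : Matrix (Lab n) (Lab n) ℂ :=
  if i = 0 then
    match T with
    | .D2 => -((csqrt (q + q⁻¹))⁻¹ • site n 1 Xm)
    | _ => -site₂ n 1 Xm Xm
  else if i < n then -site₂ n i Xp Xm
  else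
    match T with
    | .D1 => -site₂ n (n - 1) Xp Xp
    | _ => (csqrt (q + q⁻¹))⁻¹ • site n n Xp

/-- The action of the generator `H_i`, `0 ≤ i ≤ n`, in the spin representation. -/
def chevH (T : AffineType) (n : ℕ) (i : ℕ) : Matrix (Lab n) (Lab n) ℂ :=
  if i = 0 then
    match T with
    | .D2 => -site n 1 Hm
    | _ => -(site n 1 Hm + site n 2 Hm)
  else if i < n then site n i Hm - site n (i + 1) Hm
  else
    match T with
    | .D1 => site n (n - 1) Hm + site n n Hm
    | _ => site n n Hm

/-- `q^{c H}` for a diagonal matrix `H`. -/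
def qPow {n : ℕ} (q c : ℂ) (H : Matrix (Lab n) (Lab n) ℂ) : Matrix (Lab n) (Lab n) ℂ :=
  Matrix.diagonal fun α => q ^ (c * H α α)

/-- The coproduct `q^H ⊗ X + X ⊗ q^{-H}` of a generator `X = X^±_i` with `H = H_i`. -/
def coprodX {n : ℕ} (q : ℂ) (X H : Matrix (Lab n) (Lab n) ℂ) :
    Matrix (Lab n × Lab n) (Lab n × Lab n) ℂ :=
  qPow q 1 H ⊗ₖ X + X ⊗ₖ qPow q (-1) H

/-- The coproduct `H ⊗ 1 + 1 ⊗ H`. -/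
def coprodH {n : ℕ} (H : Matrix (Lab n) (Lab n) ℂ) :
    Matrix (Lab n × Lab n) (Lab n × Lab n) ℂ :=
  H ⊗ₖ 1 + 1 ⊗ₖ H

/-! ## The quantum `R` matrices of spin representations -/

/-- Extension of scalars from `ℂ` to `ℂ(x)`. -/
def toRat {n : ℕ} (M : Matrix (Lab n × Lab n) (Lab n × Lab n) ℂ) :
    Matrix (Lab n × Lab n) (Lab n × Lab n) (RatFunc ℂ) :=
  M.map (algebraMap ℂ (RatFunc ℂ))

/-- `Ř = P R` with `P (u ⊗ v) = v ⊗ u`. -/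
def check {n : ℕ} {K : Type} (R : Matrix (Lab n × Lab n) (Lab n × Lab n) K) :
    Matrix (Lab n × Lab n) (Lab n × Lab n) K :=
  R.submatrix Prod.swap id

/-- The sign `(-1)^{α₁ + ⋯ + α_n}`, so that `v_α ∈ 𝐕_±` when it is `±1`. -/
def parity {n : ℕ} (α : Lab n) : ℤ := (-1) ^ (∑ j, (α j : ℕ))

/-- The label `(0, …, 0, α)`. -/
def lastLab (n : ℕ) (α : Fin 2) : Lab n := fun j => if (j : ℕ) + 1 = n then α else 0

/-- The components `𝐕_ε ⊗ 𝐕_ε' → 𝐕_κ ⊗ 𝐕_κ'` with `(κ, κ') ≠ (ε, ε')` vanish. -/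
def ParityPreserving {n : ℕ} {K : Type} [Zero K]
    (R : Matrix (Lab n × Lab n) (Lab n × Lab n) K) : Prop :=
  ∀ a' a, (parity a'.1 ≠ parity a.1 ∨ parity a'.2 ≠ parity a.2) → R a' a = 0

/-- The normalization of the quantum `R` matrix; for `D^{(1)}_n` there is one condition on each
of the four blocks `𝐕_ε ⊗ 𝐕_ε'`, and the components between different blocks are zero. -/
def Normalized {n : ℕ} (T : AffineType)
    (R : Matrix (Lab n × Lab n) (Lab n × Lab n) (RatFunc ℂ)) : Prop :=
  match T with
  | .D1 => ParityPreserving R ∧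
      ∀ α β : Fin 2, R (lastLab n α, lastLab n β) (lastLab n α, lastLab n β) = 1
  | _ => R (0, 0) (0, 0) = 1

/-- `R = R(x)`, a matrix of rational functions of `x` acting on `𝐕 ⊗ 𝐕`, is the normalized
quantum `R` matrix of the spin representation. -/
structure IsQuantumR (T : AffineType) (n : ℕ) (q : ℂ)
    (R : Matrix (Lab n × Lab n) (Lab n × Lab n) (RatFunc ℂ)) : Prop where
  comm_Xp : ∀ i, 1 ≤ i → i ≤ n →
    check R * toRat (coprodX q (chevX T n q i) (chevH T n i)) =
      toRat (coprodX q (chevX T n q i) (chevH T n i)) * check R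
  comm_Xm : ∀ i, 1 ≤ i → i ≤ n →
    check R * toRat (coprodX q (chevX T n q i).transpose (chevH T n i)) =
      toRat (coprodX q (chevX T n q i).transpose (chevH T n i)) * check R
  comm_H : ∀ i, 1 ≤ i → i ≤ n →
    check R * toRat (coprodH (chevH T n i)) = toRat (coprodH (chevH T n i)) * check R
  zero_action :
    check R * (toRat (qPow q 1 (chevH T n 0) ⊗ₖ chevX T n q 0) +
        (RatFunc.X : RatFunc ℂ) • toRat (chevX T n q 0 ⊗ₖ qPow q (-1) (chevH T n 0))) =
      ((RatFunc.X : RatFunc ℂ) • toRat (qPow q 1 (chevH T n 0) ⊗ₖ chevX T n q 0) +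
        toRat (chevX T n q 0 ⊗ₖ qPow q (-1) (chevH T n 0))) * check R
  normalized : Normalized T R

section Expansion

open scoped RatFunc

/-- The rational function matrix `R` and the power series matrix `S` agree, i.e. the entries of
`S` are the expansions at `x = 0` of the entries of `R`. -/
def Agrees {n : ℕ} (R : Matrix (Lab n × Lab n) (Lab n × Lab n) (RatFunc ℂ))
    (S : Matrix (Lab n × Lab n) (Lab n × Lab n) (PowerSeries ℂ)) : Prop :=
  R.map (algebraMap (RatFunc ℂ) (LaurentSeries ℂ)) = S.map (HahnSeries.ofPowerSeries ℤ ℂ)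

end Expansion

/-! ## Consistency checks -/

/-- For `|b| < 1` the coefficients `invQCoeff b j` are indeed those of the expansion of
`1 / (z; b)_∞`, where `(z; b)_∞ = ∏_{i ≥ 0} (1 - z b ^ i)`. -/
theorem hasSum_invQCoeff (b z : ℂ) (hb : ‖b‖ < 1) (hz : ‖z‖ < 1) :
    HasSum (fun j => invQCoeff b j * z ^ j) (∏' i : ℕ, (1 - z * b ^ i))⁻¹ := by
  have hne : ∀ j : ℕ, 1 - b ^ (j + 1) ≠ 0 := by
    intro j hj
    have h1 : ‖b ^ (j + 1)‖ < 1 := by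
      rw [norm_pow]
      exact pow_lt_one₀ (norm_nonneg _) hb (Nat.succ_ne_zero j)
    rw [← sub_eq_zero.mp hj] at h1
    simp at h1
  have hrec : ∀ j : ℕ, invQCoeff b (j + 1) * (1 - b ^ (j + 1)) = invQCoeff b j := by
    intro j
    have := hne j
    simp only [invQCoeff, Finset.prod_range_succ, mul_inv]
    field_simp
  have hcne : ∀ j : ℕ, invQCoeff b j ≠ 0 := fun j =>
    inv_ne_zero (Finset.prod_ne_zero_iff.mpr fun i _ => hne i)
  have hb0 : Filter.Tendsto (fun j : ℕ => b ^ (j + 1)) Filter.atTop (nhds 0) :=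
    (tendsto_pow_atTop_nhds_zero_of_norm_lt_one hb).comp (Filter.tendsto_add_atTop_nat 1)
  have hsum : ∀ w : ℂ, ‖w‖ < 1 → Summable fun j => ‖invQCoeff b j * w ^ j‖ := by
    intro w hw
    by_cases hw0 : w = 0
    · refine summable_of_ne_finset_zero (s := {0}) fun j hj => ?_
      have hj0 : j ≠ 0 := by simpa using hj
      simp [hw0, hj0]
    refine summable_of_ratio_test_tendsto_lt_one hw (Filter.Eventually.of_forall fun j => ?_) ?_
    · simp [hcne j, hw0]
    · have h2 : Filter.Tendsto (fun j : ℕ => ‖w‖ / ‖1 - b ^ (j + 1)‖) Filter.atTop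
          (nhds (‖w‖ / ‖(1 : ℂ) - 0‖)) :=
        tendsto_const_nhds.div (tendsto_const_nhds.sub hb0).norm (by simp)
      rw [sub_zero, norm_one, div_one] at h2
      refine h2.congr fun j => ?_
      have hn1 : ‖1 - b ^ (j + 1)‖ ≠ 0 := norm_ne_zero_iff.mpr (hne j)
      have hn2 : ‖invQCoeff b (j + 1)‖ ≠ 0 := norm_ne_zero_iff.mpr (hcne (j + 1))
      have hn3 : ‖w‖ ≠ 0 := norm_ne_zero_iff.mpr hw0
      rw [← hrec j]
      simp only [norm_norm, norm_mul, norm_pow]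
      field_simp
      ring
  set g : ℂ → ℂ := fun w => ∑' j, invQCoeff b j * w ^ j with hg
  have hfun : ∀ w : ℂ, ‖w‖ < 1 → (1 - w) * g w = g (b * w) := by
    intro w hw
    have hbw : ‖b * w‖ < 1 := by
      rw [norm_mul]
      nlinarith [norm_nonneg b, norm_nonneg w]
    have s1 := (hsum w hw).of_norm
    have s2 := (hsum (b * w) hbw).of_norm
    have e1 : g w - g (b * w) = w * g w := by
      simp only [hg]
      rw [← s1.tsum_sub s2, (s1.sub s2).tsum_eq_zero_add, ← tsum_mul_left]
      simp only [pow_zero, sub_self, zero_add]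
      refine tsum_congr fun j => ?_
      rw [← hrec j]
      ring
    linear_combination e1
  have hprod : ∀ N : ℕ, g z * ∏ i ∈ Finset.range N, (1 - z * b ^ i) = g (b ^ N * z) := by
    intro N
    induction N with
    | zero => simp
    | succ N ih =>
      have hbn : ‖b ^ N * z‖ < 1 := by
        rw [norm_mul, norm_pow]
        have := pow_le_one₀ (norm_nonneg b) hb.le (n := N)
        nlinarith [norm_nonneg z, pow_nonneg (norm_nonneg b) N]
      rw [Finset.prod_range_succ, ← mul_assoc, ih, pow_succ', mul_assoc b, ← hfun _ hbn]
      ring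
  have hlim : Filter.Tendsto (fun N : ℕ => g (b ^ N * z)) Filter.atTop (nhds 1) := by
    have h3 : Filter.Tendsto (fun N : ℕ => g (b ^ N * z)) Filter.atTop
        (nhds (∑' j, invQCoeff b j * 0 ^ j)) := by
      refine tendsto_tsum_of_dominated_convergence (hsum z hz) (fun j => ?_)
        (Filter.Eventually.of_forall fun N j => ?_)
      · have h4 : Filter.Tendsto (fun N : ℕ => b ^ N * z) Filter.atTop (nhds (0 * z)) :=
          (tendsto_pow_atTop_nhds_zero_of_norm_lt_one hb).mul_const z
        rw [zero_mul] at h4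
        exact (h4.pow j).const_mul _
      · rw [norm_mul, norm_mul, norm_pow, norm_pow, norm_mul, norm_pow]
        have h5 : ‖b‖ ^ N * ‖z‖ ≤ ‖z‖ :=
          mul_le_of_le_one_left (norm_nonneg z) (pow_le_one₀ (norm_nonneg b) hb.le)
        gcongr
    rw [tsum_eq_single 0 (fun j hj => by simp [hj])] at h3
    simpa [invQCoeff] using h3
  have hmul : Multipliable fun i : ℕ => (1 - z * b ^ i) := by
    have := multipliable_one_add_of_summable (f := fun i : ℕ => -(z * b ^ i)) (by
      simp only [norm_neg, norm_mul, norm_pow]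
      exact (summable_geometric_of_lt_one (norm_nonneg b) hb).mul_left _)
    simpa only [sub_eq_add_neg] using this
  have hone : g z * ∏' i : ℕ, (1 - z * b ^ i) = 1 :=
    tendsto_nhds_unique ((hmul.tendsto_prod_tprod_nat.const_mul (g z)).congr hprod) hlim
  rw [← eq_inv_of_mul_eq_one_left hone]
  exact (hsum z hz).of_norm.hasSum

theorem ket_zero (h : ℂ) (hh : h ≠ 0) (t : ℕ) (y : ℂ) : ket h hh t y 0 = 1 := by
  simp [ket, invQCoeff, vac]

/-- The denominators `⟨χ̄_s(x)|χ_t(1)⟩` are invertible power series. -/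
theorem constantCoeff_sandwich_one (h : ℂ) (hh : h ≠ 0) (s t : ℕ) :
    PowerSeries.constantCoeff (sandwich h hh s t 1) = 1 := by
  rw [← PowerSeries.coeff_zero_eq_constantCoeff_apply]
  simp [sandwich, invQCoeff, ket_zero]

/-- The denominators `⟨χ̄_s(x)|(-ik)|χ_t(1)⟩` are invertible power series. -/
theorem constantCoeff_sandwich_k (h : ℂ) (hh : h ≠ 0) (s t : ℕ) :
    PowerSeries.constantCoeff (sandwich h hh s t (-Complex.I • osc (h ^ 2) .kk)) =
      -Complex.I * h := by
  rw [← PowerSeries.coeff_zero_eq_constantCoeff_apply]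
  simp [sandwich, invQCoeff, fock, oscLift_osc, fockK, ket_zero]

end

end SpinR

/-! Existence, uniqueness and the expansion formula come out together; rationality of the series in
the layer matrices is never proved directly.

The layer matrix solves the linear equations over ℂ[[x]]. A Chevalley generator touches one tensor
position or two adjacent ones, so in its intertwining relation all other entries of the `L` operator
form a fixed prefix P and suffix S. For 1 ≤ i < n the relation holds already in the oscillator
algebra (`local_bulk`), whatever linear form is applied. For i = n the suffix is empty, and what is
missing is supplied by the ket: a⁺ and a⁻ act on |χ₁⟩ as combinations of 1 and k, and they agree on
|χ₂⟩. For i = 0 the prefix is empty and the bra satisfies the mirrored relations, with factors x.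
These boundary relations (`rightOne_sandwich`, `rightTwo_sandwich`, `leftOne_sandwich`,
`leftTwo_sandwich`) are first order recursions for the coefficients of the boundary vectors. They
lead to `layerR_isIntertwiner`; the normalization is `calR_normalizedAt`.

Over ℂ((x)) a solution is determined by its normalization. The difference of two normalized
solutions has normalization 0, and its lowest coefficient in x solves the equations at x = 0. There
X⁺₀ on the first tensor factor drops out of the source side. Hence if X⁺₁, …, X⁺_n kill v_α and Ř
kills v_α ⊗ v_β, then Ř kills v_α ⊗ X⁺_i v_β for all 0 ≤ i ≤ n. The X⁺_i generate every v_β from the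
highest weight labels, and afterwards X⁻₁, …, X⁻_n generate every v_α. The start, highest ⊗ highest,
follows from weight conservation, parity and the normalization (`eq_zero_of_isIntertwiner_zero`,
`eq_zero_of_isIntertwiner_laurent`).

The equations are linear over ℂ(x). A ℂ(x)-linear retraction of ℂ((x)) onto ℂ(x), applied to each
entry of the series solution, therefore gives a rational solution. By uniqueness over ℂ((x)), every
rational solution expands to the layer matrix (`existsUnique_isQuantumR`). -/

namespace SpinR

noncomputable section

/-! ## Ordered products over the tensor positions -/

/-- A square matrix acting on `ℂ² ⊗ ℂ²`, with entries in `A`. -/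
abbrev Local (A : Type) : Type := Matrix (Fin 2 × Fin 2) (Fin 2 × Fin 2) A

/-- The matrix on `𝐕 ⊗ 𝐕` whose entries are the ordered products of entries of local matrices;
tensor positions are numbered from `1` to `n`. -/
def layer {A : Type} [Monoid A] (n : ℕ) (f : ℕ → Local A) :
    Matrix (Lab n × Lab n) (Lab n × Lab n) A :=
  Matrix.of fun a' a =>
    (List.ofFn fun j : Fin n => f ((j : ℕ) + 1) (a'.1 j, a'.2 j) (a.1 j, a.2 j)).prod

/-- Multiplication of a matrix over `A` by a scalar matrix from the right. -/
def rmul {A : Type} [Ring A] [Algebra ℂ A] (f : Local A) (g : Local ℂ) : Local A :=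
  Matrix.of fun a' a => ∑ c, g c a • f a' c

/-- Multiplication of a matrix over `A` by a scalar matrix from the left. -/
def lmul {A : Type} [Ring A] [Algebra ℂ A] (g : Local ℂ) (f : Local A) : Local A :=
  Matrix.of fun a' a => ∑ c, g a' c • f c a

/-- Scalars are central, so the sum over labels factorises position by position although `A` is
noncommutative. This makes multiplication of a layer matrix by a tensor product operator a local
operation. -/
theorem sum_smul_ofFn_prod {A κ : Type} [Ring A] [Algebra ℂ A] [Fintype κ] (n : ℕ)
    (g : Fin n → κ → ℂ) (f : Fin n → κ → A) :
    ∑ b : Fin n → κ, (List.ofFn fun j => g j (b j)).prod • (List.ofFn fun j => f j (b j)).prod =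
      (List.ofFn fun j => ∑ c, g j c • f j c).prod := by
  induction n with
  | zero => simp
  | succ n ih =>
    rw [← (Fin.consEquiv fun _ : Fin (n + 1) => κ).sum_comp, Fintype.sum_prod_type]
    simp only [List.ofFn_succ, List.prod_cons, Fin.consEquiv_apply, Fin.cons_zero, Fin.cons_succ]
    rw [← ih, Finset.sum_mul_sum]
    refine Finset.sum_congr rfl fun c _ => Finset.sum_congr rfl fun b _ => ?_
    rw [smul_mul_smul_comm]

theorem sum_lab_pair {M κ : Type} [AddCommMonoid M] [Fintype κ] [DecidableEq κ] (n : ℕ)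
    (F : (Fin n → κ) × (Fin n → κ) → M) :
    ∑ b, F b = ∑ b : Fin n → κ × κ, F (fun j => (b j).1, fun j => (b j).2) :=
  ((Equiv.arrowProdEquivProdArrow (Fin n) (fun _ => κ) (fun _ => κ)).sum_comp F).symm

theorem sum_layer_rmul {A : Type} [Ring A] [Algebra ℂ A] (n : ℕ) (f : ℕ → Local A)
    (g : ℕ → Local ℂ) (a' a : Lab n × Lab n) :
    ∑ b, layer n g b a • layer n f a' b = layer n (fun j => rmul (f j) (g j)) a' a := by
  rw [sum_lab_pair]
  simpa [layer, rmul] using sum_smul_ofFn_prod n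
    (fun j (c : Fin 2 × Fin 2) => g ((j : ℕ) + 1) c (a.1 j, a.2 j))
    (fun j c => f ((j : ℕ) + 1) (a'.1 j, a'.2 j) c)

theorem sum_layer_lmul {A : Type} [Ring A] [Algebra ℂ A] (n : ℕ) (f : ℕ → Local A)
    (g : ℕ → Local ℂ) (a' a : Lab n × Lab n) :
    ∑ b, layer n g a' b • layer n f b a = layer n (fun j => lmul (g j) (f j)) a' a := by
  rw [sum_lab_pair]
  simpa [layer, lmul] using sum_smul_ofFn_prod n
    (fun j (c : Fin 2 × Fin 2) => g ((j : ℕ) + 1) (a'.1 j, a'.2 j) c)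
    (fun j c => f ((j : ℕ) + 1) c (a.1 j, a.2 j))

theorem rmul_one {A : Type} [Ring A] [Algebra ℂ A] (f : Local A) : rmul f 1 = f := by
  ext a' a
  simp [rmul, Matrix.one_apply]

theorem lmul_one {A : Type} [Ring A] [Algebra ℂ A] (f : Local A) : lmul 1 f = f := by
  ext a' a
  simp [lmul, Matrix.one_apply]

/-- The part of an ordered product outside one position. -/
theorem exists_ofFn_prod_eq {A : Type} [Monoid A] (n i : ℕ) (hi : i < n) (e : Fin n → A) :
    ∃ P S : A, (i = 0 → P = 1) ∧ (i + 1 = n → S = 1) ∧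
      -- `P` and `S` depend on `e` only, so one pair serves all four terms of an intertwining
      -- relation.
      ∀ f : Fin n → A, (∀ j : Fin n, (j : ℕ) ≠ i → f j = e j) →
        (List.ofFn f).prod = P * f ⟨i, hi⟩ * S := by
  induction n generalizing i with
  | zero => omega
  | succ n ih =>
    rcases i with _ | i
    · refine ⟨1, (List.ofFn fun j : Fin n => e j.succ).prod, fun _ => rfl, fun h => ?_,
        fun f hf => ?_⟩
      · obtain rfl : n = 0 := by omega
        simp
      · rw [List.ofFn_succ, List.prod_cons, one_mul]
        congr 3
        funext j
        exact hf _ (by simp)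
    · obtain ⟨P, S, -, hS, h⟩ := ih i (by omega) fun j => e j.succ
      refine ⟨e 0 * P, S, by omega, fun h' => hS (by omega), fun f hf => ?_⟩
      rw [List.ofFn_succ, List.prod_cons, hf 0 (by simp), h (fun j => f j.succ)
        fun j hj => hf _ (by simpa using hj)]
      simp [mul_assoc]

/-- The part of an ordered product outside two adjacent positions. -/
theorem exists_ofFn_prod_eq₂ {A : Type} [Monoid A] (n i : ℕ) (hi : i + 1 < n) (e : Fin n → A) :
    ∃ P S : A, (i = 0 → P = 1) ∧ (i + 2 = n → S = 1) ∧
      ∀ f : Fin n → A, (∀ j : Fin n, (j : ℕ) ≠ i → (j : ℕ) ≠ i + 1 → f j = e j) →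
        (List.ofFn f).prod = P * (f ⟨i, by omega⟩ * f ⟨i + 1, hi⟩) * S := by
  induction n generalizing i with
  | zero => omega
  | succ n ih =>
    rcases i with _ | i
    · obtain ⟨n, rfl⟩ : ∃ m, n = m + 1 := ⟨n - 1, by omega⟩
      refine ⟨1, (List.ofFn fun j : Fin n => e j.succ.succ).prod, fun _ => rfl, fun h => ?_,
        fun f hf => ?_⟩
      · obtain rfl : n = 0 := by omega
        simp
      · rw [List.ofFn_succ, List.prod_cons, List.ofFn_succ, List.prod_cons, one_mul, mul_assoc]
        congr 4
        funext j
        exact hf _ (by simp) (by simp)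
    · obtain ⟨P, S, -, hS, h⟩ := ih i (by omega) fun j => e j.succ
      refine ⟨e 0 * P, S, by omega, fun h' => hS (by omega), fun f hf => ?_⟩
      rw [List.ofFn_succ, List.prod_cons, hf 0 (by simp) (by simp), h (fun j => f j.succ)
        fun j hj hj' => hf _ (by simpa using hj) (by simpa using hj')]
      simp [mul_assoc]

/-! ## Tensor product operators as products of local matrices -/

theorem tens_kronecker_tens (n : ℕ) (f g : ℕ → Matrix (Fin 2) (Fin 2) ℂ) :
    tens n f ⊗ₖ tens n g = layer n fun j => f j ⊗ₖ g j := by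
  ext a' a
  simp [tens, layer, List.prod_ofFn, Finset.prod_mul_distrib]

/-- The matrix `diag(r, r⁻¹)`. -/
def Dm (r : ℂ) : Matrix (Fin 2) (Fin 2) ℂ := !![r, 0; 0, r⁻¹]

theorem tens_diagonal (n : ℕ) (w : ℕ → Fin 2 → ℂ) :
    tens n (fun j => Matrix.diagonal (w j)) =
      Matrix.diagonal fun α => ∏ j : Fin n, w ((j : ℕ) + 1) (α j) := by
  ext α' α
  by_cases h : α' = α
  · subst h
    simp [tens]
  · obtain ⟨j, hj⟩ := Function.ne_iff.mp h
    rw [Matrix.diagonal_apply_ne _ h]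
    exact Finset.prod_eq_zero (Finset.mem_univ j) (Matrix.diagonal_apply_ne _ hj)

/-- An additive diagonal exponentiates to a product over the positions, since exponents of the fixed
base `q ≠ 0` add. -/
theorem qPow_eq_tens {n : ℕ} {q : ℂ} (hq : q ≠ 0) (c : ℂ) (H : Matrix (Lab n) (Lab n) ℂ)
    (w : ℕ → Fin 2 → ℂ) (hw : ∀ α, H α α = ∑ j : Fin n, w ((j : ℕ) + 1) (α j)) :
    qPow q c H = tens n fun j => Matrix.diagonal fun a => q ^ (c * w j a) := by
  rw [tens_diagonal, qPow]
  congr 1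
  funext α
  rw [hw, Finset.mul_sum]
  induction (Finset.univ : Finset (Fin n)) using Finset.induction_on with
  | empty => simp
  | insert j s hj ih => rw [Finset.sum_insert hj, Finset.prod_insert hj, Complex.cpow_add _ _ hq, ih]

/-- The matrix `u` at position `i`. -/
def at₁ (i : ℕ) (u : Matrix (Fin 2) (Fin 2) ℂ) : ℕ → Matrix (Fin 2) (Fin 2) ℂ :=
  fun j => if j = i then u else 1

/-- The matrices `u` and `v` at positions `i` and `i + 1`. -/
def at₂ (i : ℕ) (u v : Matrix (Fin 2) (Fin 2) ℂ) : ℕ → Matrix (Fin 2) (Fin 2) ℂ :=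
  fun j => if j = i then u else if j = i + 1 then v else 1

theorem site_eq_tens (n i : ℕ) (u : Matrix (Fin 2) (Fin 2) ℂ) : site n i u = tens n (at₁ i u) := rfl

theorem site₂_eq_tens (n i : ℕ) (u v : Matrix (Fin 2) (Fin 2) ℂ) :
    site₂ n i u v = tens n (at₂ i u v) := rfl

theorem site_Hm_eq_diagonal (n i : ℕ) (hi : 1 ≤ i) (hin : i ≤ n) :
    site n i Hm = Matrix.diagonal fun α => ∑ j : Fin n, if (j : ℕ) + 1 = i then Hm (α j) (α j) else 0 := by
  have : (fun j => if j = i then Hm else 1) =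
      fun j => Matrix.diagonal fun a => if j = i then Hm a a else 1 := by
    funext j
    split_ifs with h
    · ext a b
      fin_cases a <;> fin_cases b <;> simp [Hm]
    · ext a b
      simp [Matrix.one_apply, Matrix.diagonal_apply]
  rw [site, this, tens_diagonal]
  congr 1
  funext α
  have hk : ∀ k : Fin n, (k : ℕ) + 1 = i ↔ k = ⟨i - 1, by omega⟩ := fun k => by
    rw [Fin.ext_iff]
    simp only
    omega
  simp [hk]

theorem diagonal_cpow_Hm (q c : ℂ) :
    (Matrix.diagonal fun a => q ^ (c * Hm a a)) = Dm (q ^ (c / 2)) := by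
  ext a b
  fin_cases a <;> fin_cases b <;> simp [Hm, Dm, div_eq_mul_inv, Complex.cpow_neg]

theorem qPow_smul_site {n i : ℕ} {q : ℂ} (hq : q ≠ 0) (hi : 1 ≤ i) (hin : i ≤ n) (c ε : ℂ) :
    qPow q c (ε • site n i Hm) = tens n (at₁ i (Dm (q ^ (c * ε / 2)))) := by
  rw [qPow_eq_tens hq c _ fun j a => if j = i then ε * Hm a a else 0]
  · congr 1
    funext j
    rw [at₁, ← diagonal_cpow_Hm]
    split_ifs
    · simp [mul_assoc]
    · simp
  · intro α
    simp [site_Hm_eq_diagonal n i hi hin, Finset.mul_sum]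

theorem qPow_smul_site_add {n i : ℕ} {q : ℂ} (hq : q ≠ 0) (hi : 1 ≤ i) (hin : i + 1 ≤ n)
    (c ε ε' : ℂ) :
    qPow q c (ε • site n i Hm + ε' • site n (i + 1) Hm) =
      tens n (at₂ i (Dm (q ^ (c * ε / 2))) (Dm (q ^ (c * ε' / 2)))) := by
  rw [qPow_eq_tens hq c _ fun j a =>
    (if j = i then ε * Hm a a else 0) + if j = i + 1 then ε' * Hm a a else 0]
  · congr 1
    funext j
    simp only [at₂, ← diagonal_cpow_Hm]
    split_ifs with h h'
    · omega
    · simp [mul_assoc]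
    · simp [mul_assoc]
    · simp
  · intro α
    simp [site_Hm_eq_diagonal n i hi (by omega), site_Hm_eq_diagonal n (i + 1) (by omega) hin,
      Finset.mul_sum, Finset.sum_add_distrib]

/-! ### Local relations of the `L` operator, in the bulk and at the two ends. -/

/-- The `L` operator as a local matrix. -/
def Lmat (p : ℂ) : Local (Osc p) := Matrix.of fun a' a => Lop p a'.1 a'.2 a.1 a.2

/-- Here r = q^{1/2}. The identity is checked on all 256 entries after the four defining relations
have brought the products into normal order; no linear form is involved. -/
theorem local_bulk {p r : ℂ} (hr : r ≠ 0) (hp : p = -r ^ 4) : ∀ a' a b' b : Fin 2 × Fin 2,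
    rmul (Lmat p) (Dm r ⊗ₖ Xp) a' a * rmul (Lmat p) (Dm r⁻¹ ⊗ₖ Xm) b' b +
      rmul (Lmat p) (Xp ⊗ₖ Dm r⁻¹) a' a * rmul (Lmat p) (Xm ⊗ₖ Dm r) b' b =
    lmul (Xp ⊗ₖ Dm r) (Lmat p) a' a * lmul (Xm ⊗ₖ Dm r⁻¹) (Lmat p) b' b +
      lmul (Dm r⁻¹ ⊗ₖ Xp) (Lmat p) a' a * lmul (Dm r ⊗ₖ Xm) (Lmat p) b' b := by
  have h1 := osc_k_ap p
  have h2 := osc_k_am p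
  have h3 := osc_ap_am p
  have h4 := osc_am_ap p
  simp only [Prod.forall, Fin.forall_fin_two]
  simp [rmul, lmul, Fintype.sum_prod_type, Fin.sum_univ_two, Lmat, Lop, Dm, Xp, Xm, h1, h2, h3, h4]
  subst hp
  simp only [pow_two (osc _ _)]
  repeat' apply And.intro
  all_goals match_scalars <;> field_simp <;> ring_nf <;> simp

theorem local_bulk_transpose {p r : ℂ} (hr : r ≠ 0) (hp : p = -r ^ 4) : ∀ a' a b' b : Fin 2 × Fin 2,
    rmul (Lmat p) (Dm r ⊗ₖ Xm) a' a * rmul (Lmat p) (Dm r⁻¹ ⊗ₖ Xp) b' b +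
      rmul (Lmat p) (Xm ⊗ₖ Dm r⁻¹) a' a * rmul (Lmat p) (Xp ⊗ₖ Dm r) b' b =
    lmul (Xm ⊗ₖ Dm r) (Lmat p) a' a * lmul (Xp ⊗ₖ Dm r⁻¹) (Lmat p) b' b +
      lmul (Dm r⁻¹ ⊗ₖ Xm) (Lmat p) a' a * lmul (Dm r ⊗ₖ Xp) (Lmat p) b' b := by
  have h1 := osc_k_ap p
  have h2 := osc_k_am p
  have h3 := osc_ap_am p
  have h4 := osc_am_ap p
  simp only [Prod.forall, Fin.forall_fin_two]
  simp [rmul, lmul, Fintype.sum_prod_type, Fin.sum_univ_two, Lmat, Lop, Dm, Xp, Xm, h1, h2, h3, h4]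
  subst hp
  simp only [pow_two (osc _ _)]
  repeat' apply And.intro
  all_goals match_scalars <;> field_simp <;> ring_nf <;> simp

/-- The hypotheses on `ψ` are what a⁺|χ⟩ = a⁻|χ⟩ implies for the quadratic words that occur: move
a^± to the right end, exchange it there, and use the defining relations. -/
theorem local_right₂ {p r : ℂ} (hr : r ≠ 0) (hp : p = -r ^ 4) {K : Type} [CommRing K] [Algebra ℂ K]
    (ψ : Osc p →ₗ[ℂ] K) (g₀ : ψ (osc p .ap) = ψ (osc p .am))
    (g₁ : ψ (osc p .ap * osc p .kk) = (p⁻¹ * p⁻¹) • ψ (osc p .am * osc p .kk))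
    (g₂ : ψ (osc p .ap * osc p .ap) = ψ 1 - p⁻¹ • ψ (osc p .kk * osc p .kk))
    (g₃ : ψ (osc p .am * osc p .am) = ψ 1 - p • ψ (osc p .kk * osc p .kk)) :
    ∀ a' a b' b : Fin 2 × Fin 2,
    ψ (rmul (Lmat p) (Dm r ⊗ₖ Xp) a' a * rmul (Lmat p) (Dm r ⊗ₖ Xp) b' b) +
      ψ (rmul (Lmat p) (Xp ⊗ₖ Dm r⁻¹) a' a * rmul (Lmat p) (Xp ⊗ₖ Dm r⁻¹) b' b) =
    ψ (lmul (Xp ⊗ₖ Dm r) (Lmat p) a' a * lmul (Xp ⊗ₖ Dm r) (Lmat p) b' b) +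
      ψ (lmul (Dm r⁻¹ ⊗ₖ Xp) (Lmat p) a' a * lmul (Dm r⁻¹ ⊗ₖ Xp) (Lmat p) b' b) := by
  have h1 := osc_k_ap p
  have h2 := osc_k_am p
  simp only [Prod.forall, Fin.forall_fin_two]
  simp [rmul, lmul, Fintype.sum_prod_type, Fin.sum_univ_two, Lmat, Lop, Dm, Xp, h1, h2, g₀, g₁, g₂, g₃]
  subst hp
  repeat' apply And.intro
  all_goals match_scalars <;> field_simp <;> ring_nf <;> simp

theorem local_right₂_transpose {p r : ℂ} (hr : r ≠ 0) (hp : p = -r ^ 4) {K : Type} [CommRing K] [Algebra ℂ K]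
    (ψ : Osc p →ₗ[ℂ] K) (g₀ : ψ (osc p .ap) = ψ (osc p .am))
    (g₁ : ψ (osc p .ap * osc p .kk) = (p⁻¹ * p⁻¹) • ψ (osc p .am * osc p .kk))
    (g₂ : ψ (osc p .ap * osc p .ap) = ψ 1 - p⁻¹ • ψ (osc p .kk * osc p .kk))
    (g₃ : ψ (osc p .am * osc p .am) = ψ 1 - p • ψ (osc p .kk * osc p .kk)) :
    ∀ a' a b' b : Fin 2 × Fin 2,
    ψ (rmul (Lmat p) (Dm r ⊗ₖ Xm) a' a * rmul (Lmat p) (Dm r ⊗ₖ Xm) b' b) +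
      ψ (rmul (Lmat p) (Xm ⊗ₖ Dm r⁻¹) a' a * rmul (Lmat p) (Xm ⊗ₖ Dm r⁻¹) b' b) =
    ψ (lmul (Xm ⊗ₖ Dm r) (Lmat p) a' a * lmul (Xm ⊗ₖ Dm r) (Lmat p) b' b) +
      ψ (lmul (Dm r⁻¹ ⊗ₖ Xm) (Lmat p) a' a * lmul (Dm r⁻¹ ⊗ₖ Xm) (Lmat p) b' b) := by
  have h1 := osc_k_ap p
  have h2 := osc_k_am p
  simp only [Prod.forall, Fin.forall_fin_two]
  simp [rmul, lmul, Fintype.sum_prod_type, Fin.sum_univ_two, Lmat, Lop, Dm, Xm, h1, h2, g₀, g₁, g₂, g₃]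
  subst hp
  repeat' apply And.intro
  all_goals match_scalars <;> field_simp <;> ring_nf <;> simp

/-- The bra version, with a⁺ replaced by ξ a⁻ at the left end. There is no transposed companion,
because the spectral parameter enters only through X⁺₀. -/
theorem local_left₂ {p r : ℂ} (hr : r ≠ 0) (hp : p = -r ^ 4) {K : Type} [CommRing K] [Algebra ℂ K] (ξ : K)
    (ψ : Osc p →ₗ[ℂ] K) (g₀ : ψ (osc p .ap) = ξ * ψ (osc p .am))
    (g₁ : ψ (osc p .ap * osc p .kk) = ξ * ψ (osc p .am * osc p .kk))
    (g₂ : ψ (osc p .ap * osc p .ap) = ξ * ψ 1 - p • (ξ * ψ (osc p .kk * osc p .kk)))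
    (g₃ : ξ * ψ (osc p .am * osc p .am) = ψ 1 - p⁻¹ • ψ (osc p .kk * osc p .kk)) :
    ∀ a' a b' b : Fin 2 × Fin 2,
    ψ (rmul (Lmat p) (Dm r⁻¹ ⊗ₖ Xm) a' a * rmul (Lmat p) (Dm r⁻¹ ⊗ₖ Xm) b' b) +
      ξ * ψ (rmul (Lmat p) (Xm ⊗ₖ Dm r) a' a * rmul (Lmat p) (Xm ⊗ₖ Dm r) b' b) =
    ξ * ψ (lmul (Xm ⊗ₖ Dm r⁻¹) (Lmat p) a' a * lmul (Xm ⊗ₖ Dm r⁻¹) (Lmat p) b' b) +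
      ψ (lmul (Dm r ⊗ₖ Xm) (Lmat p) a' a * lmul (Dm r ⊗ₖ Xm) (Lmat p) b' b) := by
  have h1 := osc_k_ap p
  have h2 := osc_k_am p
  simp only [Prod.forall, Fin.forall_fin_two]
  simp [rmul, lmul, Fintype.sum_prod_type, Fin.sum_univ_two, Lmat, Lop, Dm, Xm, h1, h2, g₀, g₁, g₂, g₃]
  subst hp
  repeat' apply And.intro
  all_goals match_scalars <;> field_simp <;> ring_nf <;> simp

/-- A single site suffices here, since the boundary vector expresses a^± through 1 and k. The square
root h = i r² of p enters, and not only p. -/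
theorem local_right₁ {p r h : ℂ} (hr : r ≠ 0) (hh : h = Complex.I * r ^ 2) {K : Type} [CommRing K] [Algebra ℂ K]
    (ψ : Osc p →ₗ[ℂ] K) (g₀ : ψ (osc p .am) = ψ 1 + h • ψ (osc p .kk))
    (g₁ : ψ (osc p .ap) = ψ 1 - h⁻¹ • ψ (osc p .kk)) : ∀ a' a : Fin 2 × Fin 2,
    ψ (rmul (Lmat p) (Dm r ⊗ₖ Xp) a' a) + ψ (rmul (Lmat p) (Xp ⊗ₖ Dm r⁻¹) a' a) =
    ψ (lmul (Xp ⊗ₖ Dm r) (Lmat p) a' a) + ψ (lmul (Dm r⁻¹ ⊗ₖ Xp) (Lmat p) a' a) := by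
  simp only [Prod.forall, Fin.forall_fin_two]
  simp [rmul, lmul, Fintype.sum_prod_type, Fin.sum_univ_two, Lmat, Lop, Dm, Xp, g₀, g₁]
  subst hh
  repeat' apply And.intro
  all_goals match_scalars <;> field_simp <;> ring_nf <;> simp

theorem local_right₁_transpose {p r h : ℂ} (hr : r ≠ 0) (hh : h = Complex.I * r ^ 2) {K : Type} [CommRing K] [Algebra ℂ K]
    (ψ : Osc p →ₗ[ℂ] K) (g₀ : ψ (osc p .am) = ψ 1 + h • ψ (osc p .kk))
    (g₁ : ψ (osc p .ap) = ψ 1 - h⁻¹ • ψ (osc p .kk)) : ∀ a' a : Fin 2 × Fin 2,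
    ψ (rmul (Lmat p) (Dm r ⊗ₖ Xm) a' a) + ψ (rmul (Lmat p) (Xm ⊗ₖ Dm r⁻¹) a' a) =
    ψ (lmul (Xm ⊗ₖ Dm r) (Lmat p) a' a) + ψ (lmul (Dm r⁻¹ ⊗ₖ Xm) (Lmat p) a' a) := by
  simp only [Prod.forall, Fin.forall_fin_two]
  simp [rmul, lmul, Fintype.sum_prod_type, Fin.sum_univ_two, Lmat, Lop, Dm, Xm, g₀, g₁]
  subst hh
  repeat' apply And.intro
  all_goals match_scalars <;> field_simp <;> ring_nf <;> simp

theorem local_left₁ {p r h : ℂ} (hr : r ≠ 0) (hh : h = Complex.I * r ^ 2) {K : Type} [CommRing K] [Algebra ℂ K] (ξ : K)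
    (ψ : Osc p →ₗ[ℂ] K) (g₀ : ψ (osc p .ap) = ξ * ψ 1 + h • (ξ * ψ (osc p .kk)))
    (g₁ : ξ * ψ (osc p .am) = ψ 1 - h⁻¹ • ψ (osc p .kk)) : ∀ a' a : Fin 2 × Fin 2,
    ψ (rmul (Lmat p) (Dm r⁻¹ ⊗ₖ Xm) a' a) + ξ * ψ (rmul (Lmat p) (Xm ⊗ₖ Dm r) a' a) =
    ξ * ψ (lmul (Xm ⊗ₖ Dm r⁻¹) (Lmat p) a' a) + ψ (lmul (Dm r ⊗ₖ Xm) (Lmat p) a' a) := by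
  simp only [Prod.forall, Fin.forall_fin_two]
  simp [rmul, lmul, Fintype.sum_prod_type, Fin.sum_univ_two, Lmat, Lop, Dm, Xm, g₀, g₁]
  subst hh
  repeat' apply And.intro
  all_goals match_scalars <;> field_simp <;> ring_nf <;> simp

/-! ## Intertwiners over a commutative algebra -/

section Intertwiner

variable {n : ℕ} {K K' : Type} [CommRing K] [Algebra ℂ K] [CommRing K'] [Algebra ℂ K']

/-- Extension of scalars of a complex matrix. -/
def baseChange (K : Type) [CommRing K] [Algebra ℂ K] (M : Matrix (Lab n × Lab n) (Lab n × Lab n) ℂ) :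
    Matrix (Lab n × Lab n) (Lab n × Lab n) K :=
  M.map (algebraMap ℂ K)

/-- `Ř` intertwines `D ⊗ X + ξ X ⊗ D'` and `ξ D ⊗ X + X ⊗ D'`. -/
def Intertwines (ξ : K) (D X D' : Matrix (Lab n) (Lab n) ℂ)
    (R : Matrix (Lab n × Lab n) (Lab n × Lab n) K) : Prop :=
  check R * (baseChange K (D ⊗ₖ X) + ξ • baseChange K (X ⊗ₖ D')) =
    (ξ • baseChange K (D ⊗ₖ X) + baseChange K (X ⊗ₖ D')) * check R

/-- `Ř` commutes with the coproduct of `H`. -/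
def PreservesWeight (H : Matrix (Lab n) (Lab n) ℂ)
    (R : Matrix (Lab n × Lab n) (Lab n × Lab n) K) : Prop :=
  check R * baseChange K (coprodH H) = baseChange K (coprodH H) * check R

/-- The linear conditions on the quantum `R` matrix, with spectral parameter `ξ`. -/
structure IsIntertwiner (T : AffineType) (n : ℕ) (q : ℂ) (ξ : K)
    (R : Matrix (Lab n × Lab n) (Lab n × Lab n) K) : Prop where
  comm_Xp : ∀ i, 1 ≤ i → i ≤ n → Intertwines 1 (qPow q 1 (chevH T n i)) (chevX T n q i)
    (qPow q (-1) (chevH T n i)) R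
  comm_Xm : ∀ i, 1 ≤ i → i ≤ n → Intertwines 1 (qPow q 1 (chevH T n i))
    (chevX T n q i).transpose (qPow q (-1) (chevH T n i)) R
  comm_H : ∀ i, 1 ≤ i → i ≤ n → PreservesWeight (chevH T n i) R
  zero_action : Intertwines ξ (qPow q 1 (chevH T n 0)) (chevX T n q 0)
    (qPow q (-1) (chevH T n 0)) R

theorem baseChange_add (A B : Matrix (Lab n × Lab n) (Lab n × Lab n) ℂ) :
    baseChange K (A + B) = baseChange K A + baseChange K B := by
  ext a b
  simp [baseChange]

theorem baseChange_smul (c : ℂ) (A : Matrix (Lab n × Lab n) (Lab n × Lab n) ℂ) :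
    baseChange K (c • A) = algebraMap ℂ K c • baseChange K A := by
  ext a b
  simp [baseChange]

theorem baseChange_submatrix_swap (A B : Matrix (Lab n) (Lab n) ℂ) :
    (baseChange K (A ⊗ₖ B)).submatrix Prod.swap Prod.swap = baseChange K (B ⊗ₖ A) := by
  ext a b
  simp [baseChange, mul_comm]

/-- The relations for i ≥ 1 are the case ξ = 1 of the relation for i = 0. Over a general algebra `K`
the same conditions can be compared over ℂ[[x]], ℂ((x)), ℂ(x) and, at x = 0, over ℂ. -/
theorem isQuantumR_iff (T : AffineType) (n : ℕ) (q : ℂ)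
    (R : Matrix (Lab n × Lab n) (Lab n × Lab n) (RatFunc ℂ)) :
    IsQuantumR T n q R ↔ IsIntertwiner T n q (RatFunc.X : RatFunc ℂ) R ∧ Normalized T R := by
  have key : ∀ X H : Matrix (Lab n) (Lab n) ℂ,
      Intertwines (1 : RatFunc ℂ) (qPow q 1 H) X (qPow q (-1) H) R ↔
        check R * toRat (coprodX q X H) = toRat (coprodX q X H) * check R := by
    intro X H
    have : toRat (coprodX q X H) =
        baseChange (RatFunc ℂ) (qPow q 1 H ⊗ₖ X) + baseChange (RatFunc ℂ) (X ⊗ₖ qPow q (-1) H) :=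
      baseChange_add _ _
    rw [Intertwines, one_smul, one_smul, this]
  constructor
  · rintro ⟨h₁, h₂, h₃, h₄, h₅⟩
    exact ⟨⟨fun i hi hin => (key _ _).mpr (h₁ i hi hin), fun i hi hin => (key _ _).mpr (h₂ i hi hin),
      h₃, h₄⟩, h₅⟩
  · rintro ⟨⟨h₁, h₂, h₃, h₄⟩, h₅⟩
    exact ⟨fun i hi hin => (key _ _).mp (h₁ i hi hin), fun i hi hin => (key _ _).mp (h₂ i hi hin),
      h₃, h₄, h₅⟩

theorem intertwines_iff {ξ : K} {D X D' : Matrix (Lab n) (Lab n) ℂ}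
    {R : Matrix (Lab n × Lab n) (Lab n × Lab n) K} :
    Intertwines ξ D X D' R ↔
      check R * baseChange K (D ⊗ₖ X) + ξ • (check R * baseChange K (X ⊗ₖ D')) =
        ξ • (baseChange K (D ⊗ₖ X) * check R) + baseChange K (X ⊗ₖ D') * check R := by
  simp [Intertwines, Matrix.mul_add, Matrix.add_mul]

/-- Moving the flip P to the left through the target coproduct exchanges its two tensor factors.
This leaves an equation for R itself, the form in which layer matrices can be handled. -/
theorem Intertwines.of_mul_eq {ξ : K} {D X D' : Matrix (Lab n) (Lab n) ℂ}
    {R : Matrix (Lab n × Lab n) (Lab n × Lab n) K}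
    (h : R * baseChange K (D ⊗ₖ X) + ξ • (R * baseChange K (X ⊗ₖ D')) =
        ξ • (baseChange K (X ⊗ₖ D) * R) + baseChange K (D' ⊗ₖ X) * R) : Intertwines ξ D X D' R := by
  have h₁ : ∀ A : Matrix (Lab n × Lab n) (Lab n × Lab n) K, check R * A = check (R * A) :=
    fun A => rfl
  have h₂ : ∀ A B : Matrix (Lab n) (Lab n) ℂ,
      baseChange K (A ⊗ₖ B) * check R = check (baseChange K (B ⊗ₖ A) * R) := by
    intro A B
    rw [← baseChange_submatrix_swap A B]
    ext a' a
    simp only [check, Matrix.mul_apply, Matrix.submatrix_apply, id, Prod.swap_swap]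
    exact ((Equiv.prodComm (Lab n) (Lab n)).sum_comp fun b => baseChange K (A ⊗ₖ B) a' b * R b.swap a).symm
  rw [intertwines_iff, h₁, h₁, h₂, h₂]
  exact congrArg check h

/-- The relation is homogeneous in `X`, so signs and the factor (q + q⁻¹)^{-1/2} play no role. -/
theorem Intertwines.smul {ξ : K} {D X D' : Matrix (Lab n) (Lab n) ℂ}
    {R : Matrix (Lab n × Lab n) (Lab n × Lab n) K} (h : Intertwines ξ D X D' R) (c : ℂ) :
    Intertwines ξ D (c • X) D' R := by
  rw [intertwines_iff] at h ⊢
  simp only [Matrix.kronecker_smul, Matrix.smul_kronecker, baseChange_smul, Matrix.mul_smul,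
    Matrix.smul_mul, smul_comm ξ, ← smul_add, h]

theorem map_mul_baseChange (φ : K →ₗ[ℂ] K') (C : Matrix (Lab n × Lab n) (Lab n × Lab n) K)
    (A : Matrix (Lab n × Lab n) (Lab n × Lab n) ℂ) :
    (C * baseChange K A).map φ = C.map φ * baseChange K' A := by
  ext a b
  simp [Matrix.mul_apply, baseChange, ← Algebra.commutes (_ : ℂ), ← Algebra.smul_def]

theorem map_baseChange_mul (φ : K →ₗ[ℂ] K') (C : Matrix (Lab n × Lab n) (Lab n × Lab n) K)
    (A : Matrix (Lab n × Lab n) (Lab n × Lab n) ℂ) :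
    (baseChange K A * C).map φ = baseChange K' A * C.map φ := by
  ext a b
  simp [Matrix.mul_apply, baseChange, ← Algebra.smul_def]

theorem PreservesWeight.map {H : Matrix (Lab n) (Lab n) ℂ}
    {R : Matrix (Lab n × Lab n) (Lab n × Lab n) K} (h : PreservesWeight H R) (φ : K →ₗ[ℂ] K') :
    PreservesWeight H (R.map φ) := by
  have := congrArg (fun M => Matrix.map M φ) h
  simp only [map_mul_baseChange, map_baseChange_mul] at this
  exact this

/-- Only ℂ-linearity and compatibility with the spectral parameter are needed, not multiplicativity.
This admits coefficient extraction and the retraction onto ℂ(x). -/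
theorem Intertwines.map {ξ : K} {ξ' : K'} {D X D' : Matrix (Lab n) (Lab n) ℂ}
    {R : Matrix (Lab n × Lab n) (Lab n × Lab n) K} (h : Intertwines ξ D X D' R) (φ : K →ₗ[ℂ] K')
    (hφ : ∀ a b, φ (ξ * R a b) = ξ' * φ (R a b)) : Intertwines ξ' D X D' (R.map φ) := by
  have hφ' : (ξ • check R).map φ = ξ' • (check R).map φ := by
    ext a b
    exact hφ _ _
  rw [intertwines_iff, ← Matrix.smul_mul, ← Matrix.mul_smul] at h ⊢
  have := congrArg (fun M => Matrix.map M φ) h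
  simp only [Matrix.map_add φ (map_add φ), map_mul_baseChange, map_baseChange_mul, hφ'] at this
  exact this

theorem IsIntertwiner.map {T : AffineType} {q : ℂ} {ξ : K} {ξ' : K'}
    {R : Matrix (Lab n × Lab n) (Lab n × Lab n) K} (h : IsIntertwiner T n q ξ R) (φ : K →ₗ[ℂ] K')
    (hφ : ∀ a b, φ (ξ * R a b) = ξ' * φ (R a b)) : IsIntertwiner T n q ξ' (R.map φ) :=
  ⟨fun i hi hin => (h.comm_Xp i hi hin).map φ (by simp),
    fun i hi hin => (h.comm_Xm i hi hin).map φ (by simp), fun i hi hin => (h.comm_H i hi hin).map φ,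
    h.zero_action.map φ hφ⟩

theorem Intertwines.sub {ξ : K} {D X D' : Matrix (Lab n) (Lab n) ℂ}
    {R S : Matrix (Lab n × Lab n) (Lab n × Lab n) K} (hR : Intertwines ξ D X D' R)
    (hS : Intertwines ξ D X D' S) : Intertwines ξ D X D' (R - S) := by
  have : check (R - S) = check R - check S := rfl
  rw [Intertwines, this, Matrix.sub_mul, Matrix.mul_sub, hR, hS]

theorem IsIntertwiner.sub {T : AffineType} {q : ℂ} {ξ : K}
    {R S : Matrix (Lab n × Lab n) (Lab n × Lab n) K} (hR : IsIntertwiner T n q ξ R)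
    (hS : IsIntertwiner T n q ξ S) : IsIntertwiner T n q ξ (R - S) := by
  refine ⟨fun i hi hin => (hR.comm_Xp i hi hin).sub (hS.comm_Xp i hi hin),
    fun i hi hin => (hR.comm_Xm i hi hin).sub (hS.comm_Xm i hi hin), fun i hi hin => ?_,
    hR.zero_action.sub hS.zero_action⟩
  have : check (R - S) = check R - check S := rfl
  rw [PreservesWeight, this, Matrix.sub_mul, Matrix.mul_sub, hR.comm_H i hi hin,
    hS.comm_H i hi hin]

theorem coprodH_add (A B : Matrix (Lab n) (Lab n) ℂ) :
    coprodH (A + B) = coprodH A + coprodH B := by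
  simp only [coprodH, Matrix.add_kronecker, Matrix.kronecker_add]
  abel

theorem coprodH_smul (c : ℂ) (A : Matrix (Lab n) (Lab n) ℂ) : coprodH (c • A) = c • coprodH A := by
  simp only [coprodH, Matrix.smul_kronecker, Matrix.kronecker_smul, smul_add]

theorem PreservesWeight.add {A B : Matrix (Lab n) (Lab n) ℂ}
    {R : Matrix (Lab n × Lab n) (Lab n × Lab n) K} (hA : PreservesWeight A R)
    (hB : PreservesWeight B R) : PreservesWeight (A + B) R := by
  rw [PreservesWeight, coprodH_add, baseChange_add, Matrix.mul_add, Matrix.add_mul, hA, hB]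

theorem PreservesWeight.smul {A : Matrix (Lab n) (Lab n) ℂ}
    {R : Matrix (Lab n × Lab n) (Lab n × Lab n) K} (hA : PreservesWeight A R) (c : ℂ) :
    PreservesWeight (c • A) R := by
  rw [PreservesWeight, coprodH_smul, baseChange_smul, Matrix.mul_smul, Matrix.smul_mul, hA]

end Intertwiner

/-! ## Intertwining relations of the layer matrices -/

section Layer

variable {p : ℂ} {n : ℕ} (φ : Osc p →ₗ[ℂ] PowerSeries ℂ)

theorem layerR_apply (a' a : Lab n × Lab n) :
    layerR n φ a' a = φ (layer n (fun _ => Lmat p) a' a) := rfl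

theorem layerR_mul_baseChange (g : ℕ → Local ℂ) (a' a : Lab n × Lab n) :
    (layerR n φ * baseChange (PowerSeries ℂ) (layer n g)) a' a =
      φ (layer n (fun j => rmul (Lmat p) (g j)) a' a) := by
  rw [← sum_layer_rmul, Matrix.mul_apply, map_sum]
  refine Finset.sum_congr rfl fun b _ => ?_
  rw [map_smul, Algebra.smul_def, mul_comm]
  rfl

theorem baseChange_mul_layerR (g : ℕ → Local ℂ) (a' a : Lab n × Lab n) :
    (baseChange (PowerSeries ℂ) (layer n g) * layerR n φ) a' a =
      φ (layer n (fun j => lmul (g j) (Lmat p)) a' a) := by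
  rw [← sum_layer_lmul, Matrix.mul_apply, map_sum]
  refine Finset.sum_congr rfl fun b _ => ?_
  rw [map_smul, Algebra.smul_def]
  rfl

/-- Outside position `i` all four products have the same factors, collected in `P` and `S`. That
these are 1 at the ends is what lets the boundary conditions act. -/
theorem layerR_intertwines₁ {i : ℕ} (hi : 1 ≤ i) (hin : i ≤ n) (u d d' : Matrix (Fin 2) (Fin 2) ℂ)
    (ξ : PowerSeries ℂ)
    (h : ∀ P S, (i = 1 → P = 1) → (i = n → S = 1) → ∀ a' a,
      φ (P * rmul (Lmat p) (d ⊗ₖ u) a' a * S) + ξ * φ (P * rmul (Lmat p) (u ⊗ₖ d') a' a * S) =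
        ξ * φ (P * lmul (u ⊗ₖ d) (Lmat p) a' a * S) + φ (P * lmul (d' ⊗ₖ u) (Lmat p) a' a * S)) :
    Intertwines ξ (tens n (at₁ i d)) (tens n (at₁ i u)) (tens n (at₁ i d')) (layerR n φ) := by
  -- Tensor positions count from 1, indices in `Fin n` from 0.
  obtain ⟨i, rfl⟩ : ∃ k, i = k + 1 := ⟨i - 1, by omega⟩
  apply Intertwines.of_mul_eq
  ext1 a' a
  simp only [Matrix.add_apply, Matrix.smul_apply, smul_eq_mul, tens_kronecker_tens, layerR_mul_baseChange,
    baseChange_mul_layerR]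
  obtain ⟨P, S, hP, hS, hf⟩ := exists_ofFn_prod_eq n i hin
    fun j => Lmat p (a'.1 j, a'.2 j) (a.1 j, a.2 j)
  simp only [layer, Matrix.of_apply]
  rw [hf _ fun j hj => by simp [at₁, hj, rmul_one], hf _ fun j hj => by simp [at₁, hj, rmul_one],
    hf _ fun j hj => by simp [at₁, hj, lmul_one], hf _ fun j hj => by simp [at₁, hj, lmul_one]]
  simpa only [at₁, if_true] using h P S (fun h => hP (by omega)) hS _ _

theorem layerR_intertwines₂ {i : ℕ} (hi : 1 ≤ i) (hin : i + 1 ≤ n)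
    (u v d e d' e' : Matrix (Fin 2) (Fin 2) ℂ) (ξ : PowerSeries ℂ)
    (h : ∀ P S, (i = 1 → P = 1) → (i + 1 = n → S = 1) → ∀ a' a b' b,
      φ (P * (rmul (Lmat p) (d ⊗ₖ u) a' a * rmul (Lmat p) (e ⊗ₖ v) b' b) * S) +
          ξ * φ (P * (rmul (Lmat p) (u ⊗ₖ d') a' a * rmul (Lmat p) (v ⊗ₖ e') b' b) * S) =
        ξ * φ (P * (lmul (u ⊗ₖ d) (Lmat p) a' a * lmul (v ⊗ₖ e) (Lmat p) b' b) * S) +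
          φ (P * (lmul (d' ⊗ₖ u) (Lmat p) a' a * lmul (e' ⊗ₖ v) (Lmat p) b' b) * S)) :
    Intertwines ξ (tens n (at₂ i d e)) (tens n (at₂ i u v)) (tens n (at₂ i d' e')) (layerR n φ) := by
  obtain ⟨i, rfl⟩ : ∃ k, i = k + 1 := ⟨i - 1, by omega⟩
  apply Intertwines.of_mul_eq
  ext1 a' a
  simp only [Matrix.add_apply, Matrix.smul_apply, smul_eq_mul, tens_kronecker_tens, layerR_mul_baseChange,
    baseChange_mul_layerR]
  obtain ⟨P, S, hP, hS, hf⟩ := exists_ofFn_prod_eq₂ n i hin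
    fun j => Lmat p (a'.1 j, a'.2 j) (a.1 j, a.2 j)
  simp only [layer, Matrix.of_apply]
  rw [hf _ fun j hj hj' => by simp [at₂, hj, hj', rmul_one],
    hf _ fun j hj hj' => by simp [at₂, hj, hj', rmul_one],
    hf _ fun j hj hj' => by simp [at₂, hj, hj', lmul_one],
    hf _ fun j hj hj' => by simp [at₂, hj, hj', lmul_one]]
  simpa [at₂] using h P S (fun h => hP (by omega)) hS _ _ _ _

end Layer

/-! ## Boundary conditions and the intertwining relations -/

section Boundary

variable {h : ℂ}

/-- The right boundary condition `a⁻|χ⟩ = (1 + h k)|χ⟩`, `a⁺|χ⟩ = (1 - h⁻¹ k)|χ⟩`. -/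
def RightOne (φ : Osc (h ^ 2) →ₗ[ℂ] PowerSeries ℂ) : Prop :=
  ∀ O, φ (O * osc _ .am) = φ O + h • φ (O * osc _ .kk) ∧
    φ (O * osc _ .ap) = φ O - h⁻¹ • φ (O * osc _ .kk)

/-- The right boundary condition `a⁺|χ⟩ = a⁻|χ⟩`. -/
def RightTwo (φ : Osc (h ^ 2) →ₗ[ℂ] PowerSeries ℂ) : Prop :=
  ∀ O, φ (O * osc _ .ap) = φ (O * osc _ .am)

/-- The left boundary condition `⟨χ|a⁺ = x ⟨χ|(1 + h k)`, `x ⟨χ|a⁻ = ⟨χ|(1 - h⁻¹ k)`. -/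
def LeftOne (φ : Osc (h ^ 2) →ₗ[ℂ] PowerSeries ℂ) : Prop :=
  ∀ O, φ (osc _ .ap * O) = PowerSeries.X * φ O + h • (PowerSeries.X * φ (osc _ .kk * O)) ∧
    PowerSeries.X * φ (osc _ .am * O) = φ O - h⁻¹ • φ (osc _ .kk * O)

/-- The left boundary condition `⟨χ|a⁺ = x ⟨χ|a⁻`. -/
def LeftTwo (φ : Osc (h ^ 2) →ₗ[ℂ] PowerSeries ℂ) : Prop :=
  ∀ O, φ (osc _ .ap * O) = PowerSeries.X * φ (osc _ .am * O)

/-- The boundary conditions that correspond to the three affine types. -/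
def Boundary (φ : Osc (h ^ 2) →ₗ[ℂ] PowerSeries ℂ) : AffineType → Prop
  | .B1 => LeftTwo φ ∧ RightOne φ
  | .D2 => LeftOne φ ∧ RightOne φ
  | .D1 => LeftTwo φ ∧ RightTwo φ

/-- The least rank of each affine type. -/
def minRank : AffineType → ℕ
  | .B1 => 2
  | .D2 => 1
  | .D1 => 3

variable {n : ℕ} {φ : Osc (h ^ 2) →ₗ[ℂ] PowerSeries ℂ}

/-! ### Transposes and q-powers of the one-site and two-site operators. -/

theorem transpose_Xp : Xp.transpose = Xm := by
  ext a b
  fin_cases a <;> fin_cases b <;> rfl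

theorem transpose_Xm : Xm.transpose = Xp := by
  ext a b
  fin_cases a <;> fin_cases b <;> rfl

theorem transpose_site (n i : ℕ) (u : Matrix (Fin 2) (Fin 2) ℂ) :
    (site n i u).transpose = site n i u.transpose := by
  ext a b
  simp only [site, tens, Matrix.transpose_apply, Matrix.of_apply]
  refine Finset.prod_congr rfl fun j _ => ?_
  split_ifs
  · rfl
  · simp [Matrix.one_apply, eq_comm]

theorem transpose_site₂ (n i : ℕ) (u v : Matrix (Fin 2) (Fin 2) ℂ) :
    (site₂ n i u v).transpose = site₂ n i u.transpose v.transpose := by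
  ext a b
  simp only [site₂, tens, Matrix.transpose_apply, Matrix.of_apply]
  refine Finset.prod_congr rfl fun j _ => ?_
  split_ifs
  · rfl
  · rfl
  · simp [Matrix.one_apply, eq_comm]

/-- The square root `q^{1/2}` used in `qPow`. -/
theorem cpow_half_mul_self (q : ℂ) : (q ^ (1 / 2 : ℂ)) ^ 2 = q := by
  rw [one_div]
  exact_mod_cast Complex.cpow_nat_inv_pow q two_ne_zero

theorem qPow_one_site {q : ℂ} (hq : q ≠ 0) {i : ℕ} (hi : 1 ≤ i) (hin : i ≤ n) :
    qPow q 1 (site n i Hm) = tens n (at₁ i (Dm (q ^ (1 / 2 : ℂ)))) := by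
  simpa using qPow_smul_site hq hi hin 1 1

theorem qPow_neg_site {q : ℂ} (hq : q ≠ 0) {i : ℕ} (hi : 1 ≤ i) (hin : i ≤ n) :
    qPow q (-1) (site n i Hm) = tens n (at₁ i (Dm (q ^ (1 / 2 : ℂ))⁻¹)) := by
  simpa [← Complex.cpow_neg, neg_div] using qPow_smul_site hq hi hin (-1) 1

theorem qPow_one_neg_site {q : ℂ} (hq : q ≠ 0) {i : ℕ} (hi : 1 ≤ i) (hin : i ≤ n) :
    qPow q 1 (-site n i Hm) = tens n (at₁ i (Dm (q ^ (1 / 2 : ℂ))⁻¹)) := by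
  simpa [← Complex.cpow_neg, neg_div] using qPow_smul_site hq hi hin 1 (-1)

theorem qPow_neg_neg_site {q : ℂ} (hq : q ≠ 0) {i : ℕ} (hi : 1 ≤ i) (hin : i ≤ n) :
    qPow q (-1) (-site n i Hm) = tens n (at₁ i (Dm (q ^ (1 / 2 : ℂ)))) := by
  simpa using qPow_smul_site hq hi hin (-1) (-1)

theorem qPow_one_site_sub {q : ℂ} (hq : q ≠ 0) {i : ℕ} (hi : 1 ≤ i) (hin : i + 1 ≤ n) :
    qPow q 1 (site n i Hm - site n (i + 1) Hm) =
      tens n (at₂ i (Dm (q ^ (1 / 2 : ℂ))) (Dm (q ^ (1 / 2 : ℂ))⁻¹)) := by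
  simpa [← Complex.cpow_neg, neg_div, ← sub_eq_add_neg] using
    qPow_smul_site_add hq hi hin 1 1 (-1)

theorem qPow_neg_site_sub {q : ℂ} (hq : q ≠ 0) {i : ℕ} (hi : 1 ≤ i) (hin : i + 1 ≤ n) :
    qPow q (-1) (site n i Hm - site n (i + 1) Hm) =
      tens n (at₂ i (Dm (q ^ (1 / 2 : ℂ))⁻¹) (Dm (q ^ (1 / 2 : ℂ)))) := by
  simpa [← Complex.cpow_neg, neg_div, ← sub_eq_add_neg] using
    qPow_smul_site_add hq hi hin (-1) 1 (-1)

theorem qPow_one_site_add {q : ℂ} (hq : q ≠ 0) {i : ℕ} (hi : 1 ≤ i) (hin : i + 1 ≤ n) :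
    qPow q 1 (site n i Hm + site n (i + 1) Hm) =
      tens n (at₂ i (Dm (q ^ (1 / 2 : ℂ))) (Dm (q ^ (1 / 2 : ℂ)))) := by
  simpa using qPow_smul_site_add hq hi hin 1 1 1

theorem qPow_neg_site_add {q : ℂ} (hq : q ≠ 0) {i : ℕ} (hi : 1 ≤ i) (hin : i + 1 ≤ n) :
    qPow q (-1) (site n i Hm + site n (i + 1) Hm) =
      tens n (at₂ i (Dm (q ^ (1 / 2 : ℂ))⁻¹) (Dm (q ^ (1 / 2 : ℂ))⁻¹)) := by
  simpa [← Complex.cpow_neg, neg_div] using qPow_smul_site_add hq hi hin (-1) 1 1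

theorem qPow_one_neg_site_add {q : ℂ} (hq : q ≠ 0) {i : ℕ} (hi : 1 ≤ i) (hin : i + 1 ≤ n) :
    qPow q 1 (-(site n i Hm + site n (i + 1) Hm)) =
      tens n (at₂ i (Dm (q ^ (1 / 2 : ℂ))⁻¹) (Dm (q ^ (1 / 2 : ℂ))⁻¹)) := by
  rw [show -(site n i Hm + site n (i + 1) Hm) =
    (-1 : ℂ) • site n i Hm + (-1 : ℂ) • site n (i + 1) Hm by module, qPow_smul_site_add hq hi hin]
  simp [← Complex.cpow_neg, neg_div]

theorem qPow_neg_neg_site_add {q : ℂ} (hq : q ≠ 0) {i : ℕ} (hi : 1 ≤ i) (hin : i + 1 ≤ n) :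
    qPow q (-1) (-(site n i Hm + site n (i + 1) Hm)) =
      tens n (at₂ i (Dm (q ^ (1 / 2 : ℂ))) (Dm (q ^ (1 / 2 : ℂ)))) := by
  rw [show -(site n i Hm + site n (i + 1) Hm) =
    (-1 : ℂ) • site n i Hm + (-1 : ℂ) • site n (i + 1) Hm by module, qPow_smul_site_add hq hi hin]
  simp

theorem cpow_half_ne_zero {q : ℂ} (hq : q ≠ 0) : q ^ (1 / 2 : ℂ) ≠ 0 := by
  simp [Complex.cpow_eq_zero_iff, hq]

theorem eq_I_mul_sq {q : ℂ} (hpq : h = Complex.I * q) :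
    h = Complex.I * (q ^ (1 / 2 : ℂ)) ^ 2 := by
  rw [cpow_half_mul_self, hpq]

theorem sq_eq_neg_pow {q : ℂ} (hpq : h = Complex.I * q) : h ^ 2 = -(q ^ (1 / 2 : ℂ)) ^ 4 := by
  rw [eq_I_mul_sq hpq, mul_pow, Complex.I_sq]
  ring

/-- The linear map `O ↦ φ (P O)`. -/
def precomp (φ : Osc (h ^ 2) →ₗ[ℂ] PowerSeries ℂ) (P : Osc (h ^ 2)) :
    Osc (h ^ 2) →ₗ[ℂ] PowerSeries ℂ :=
  φ ∘ₗ LinearMap.mulLeft ℂ P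

/-- The linear map `O ↦ φ (O S)`. -/
def postcomp (φ : Osc (h ^ 2) →ₗ[ℂ] PowerSeries ℂ) (S : Osc (h ^ 2)) :
    Osc (h ^ 2) →ₗ[ℂ] PowerSeries ℂ :=
  φ ∘ₗ LinearMap.mulRight ℂ S

theorem precomp_apply (P O : Osc (h ^ 2)) : precomp φ P O = φ (P * O) := rfl

theorem postcomp_apply (S O : Osc (h ^ 2)) : postcomp φ S O = φ (O * S) := rfl

/-- The local identity holds inside 𝒜 between any `P` and `S`, so no condition on `φ` is needed. -/
theorem intertwines_bulk (φ : Osc (h ^ 2) →ₗ[ℂ] PowerSeries ℂ) {q : ℂ} (hq : q ≠ 0)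
    (hpq : h = Complex.I * q) {i : ℕ} (hi : 1 ≤ i) (hin : i + 1 ≤ n) :
    Intertwines 1 (qPow q 1 (site n i Hm - site n (i + 1) Hm)) (site₂ n i Xp Xm)
      (qPow q (-1) (site n i Hm - site n (i + 1) Hm)) (layerR n φ) := by
  rw [qPow_one_site_sub hq hi hin, qPow_neg_site_sub hq hi hin, site₂_eq_tens]
  refine layerR_intertwines₂ φ hi hin _ _ _ _ _ _ _ fun P S _ _ a' a b' b => ?_
  rw [one_mul, one_mul, ← map_add, ← map_add, ← add_mul, ← add_mul, ← mul_add, ← mul_add,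
    local_bulk (cpow_half_ne_zero hq) (sq_eq_neg_pow hpq)]

theorem intertwines_bulk_transpose (φ : Osc (h ^ 2) →ₗ[ℂ] PowerSeries ℂ) {q : ℂ} (hq : q ≠ 0)
    (hpq : h = Complex.I * q) {i : ℕ} (hi : 1 ≤ i) (hin : i + 1 ≤ n) :
    Intertwines 1 (qPow q 1 (site n i Hm - site n (i + 1) Hm)) (site₂ n i Xm Xp)
      (qPow q (-1) (site n i Hm - site n (i + 1) Hm)) (layerR n φ) := by
  rw [qPow_one_site_sub hq hi hin, qPow_neg_site_sub hq hi hin, site₂_eq_tens]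
  refine layerR_intertwines₂ φ hi hin _ _ _ _ _ _ _ fun P S _ _ a' a b' b => ?_
  rw [one_mul, one_mul, ← map_add, ← map_add, ← add_mul, ← add_mul, ← mul_add, ← mul_add,
    local_bulk_transpose (cpow_half_ne_zero hq) (sq_eq_neg_pow hpq)]

theorem intertwines_right₁ {q : ℂ} (hφ : RightOne φ) (hq : q ≠ 0) (hpq : h = Complex.I * q)
    (hn : 1 ≤ n) {X : Matrix (Fin 2) (Fin 2) ℂ} (hX : X = Xp ∨ X = Xm) :
    Intertwines 1 (qPow q 1 (site n n Hm)) (site n n X) (qPow q (-1) (site n n Hm))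
      (layerR n φ) := by
  rw [qPow_one_site hq hn le_rfl, qPow_neg_site hq hn le_rfl, site_eq_tens]
  refine layerR_intertwines₁ φ hn le_rfl _ _ _ _ fun P S _ hS a' a => ?_
  rw [hS rfl]
  simp only [mul_one, one_mul, ← precomp_apply]
  have g₀ : precomp φ P (osc _ .am) = precomp φ P 1 + h • precomp φ P (osc _ .kk) := by
    simpa [precomp_apply] using (hφ P).1
  have g₁ : precomp φ P (osc _ .ap) = precomp φ P 1 - h⁻¹ • precomp φ P (osc _ .kk) := by
    simpa [precomp_apply] using (hφ P).2
  rcases hX with rfl | rfl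
  · exact local_right₁ (cpow_half_ne_zero hq) (eq_I_mul_sq hpq) _ g₀ g₁ a' a
  · exact local_right₁_transpose (cpow_half_ne_zero hq) (eq_I_mul_sq hpq) _ g₀ g₁ a' a

theorem intertwines_left₁ {q : ℂ} (hφ : LeftOne φ) (hq : q ≠ 0) (hpq : h = Complex.I * q)
    (hn : 1 ≤ n) :
    Intertwines PowerSeries.X (qPow q 1 (-site n 1 Hm)) (site n 1 Xm) (qPow q (-1) (-site n 1 Hm))
      (layerR n φ) := by
  rw [qPow_one_neg_site hq le_rfl hn, qPow_neg_neg_site hq le_rfl hn, site_eq_tens]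
  refine layerR_intertwines₁ φ le_rfl hn _ _ _ _ fun P S hP _ a' a => ?_
  rw [hP rfl]
  simp only [one_mul, ← postcomp_apply]
  exact local_left₁ (cpow_half_ne_zero hq) (eq_I_mul_sq hpq) _ _
    (by simpa [postcomp_apply] using (hφ S).1) (by simpa [postcomp_apply] using (hφ S).2) a' a

theorem intertwines_right₂ {q : ℂ} (hφ : RightTwo φ) (hh : h ≠ 0) (hq : q ≠ 0)
    (hpq : h = Complex.I * q) {m : ℕ} (hm : 1 ≤ m) (hn : m + 1 = n)
    {X : Matrix (Fin 2) (Fin 2) ℂ} (hX : X = Xp ∨ X = Xm) :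
    Intertwines 1 (qPow q 1 (site n m Hm + site n (m + 1) Hm)) (site₂ n m X X)
      (qPow q (-1) (site n m Hm + site n (m + 1) Hm)) (layerR n φ) := by
  rw [qPow_one_site_add hq hm hn.le, qPow_neg_site_add hq hm hn.le, site₂_eq_tens]
  refine layerR_intertwines₂ φ hm hn.le _ _ _ _ _ _ _ fun P S _ hS a' a b' b => ?_
  rw [hS hn]
  simp only [mul_one, one_mul, ← precomp_apply]
  have hp : h ^ 2 ≠ 0 := pow_ne_zero 2 hh
  -- This brings a⁺ to the right end, the only place where it may be exchanged for a⁻.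
  have e₁ : osc (h ^ 2) .ap * osc (h ^ 2) .kk = (h ^ 2)⁻¹ • (osc (h ^ 2) .kk * osc (h ^ 2) .ap) := by
    rw [osc_k_ap, smul_smul, inv_mul_cancel₀ hp, one_smul]
  have g₀ : precomp φ P (osc _ .ap) = precomp φ P (osc _ .am) := hφ P
  have g₁ : precomp φ P (osc _ .ap * osc _ .kk) =
      ((h ^ 2)⁻¹ * (h ^ 2)⁻¹) • precomp φ P (osc _ .am * osc _ .kk) := by
    rw [e₁, map_smul, precomp_apply, ← mul_assoc, hφ, mul_assoc, osc_k_am, mul_smul_comm, map_smul,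
      smul_smul, precomp_apply]
  have g₂ : precomp φ P (osc _ .ap * osc _ .ap) =
      precomp φ P 1 - (h ^ 2)⁻¹ • precomp φ P (osc _ .kk * osc _ .kk) := by
    rw [precomp_apply, ← mul_assoc, hφ, mul_assoc, osc_ap_am, ← precomp_apply, map_sub, map_smul,
      pow_two (osc _ _)]
  have g₃ : precomp φ P (osc _ .am * osc _ .am) =
      precomp φ P 1 - (h ^ 2) • precomp φ P (osc _ .kk * osc _ .kk) := by
    rw [precomp_apply, ← mul_assoc, ← hφ, mul_assoc, osc_am_ap, ← precomp_apply, map_sub, map_smul,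
      pow_two (osc _ _)]
  rcases hX with rfl | rfl
  · exact local_right₂ (cpow_half_ne_zero hq) (sq_eq_neg_pow hpq) _ g₀ g₁ g₂ g₃ a' a b' b
  · exact local_right₂_transpose (cpow_half_ne_zero hq) (sq_eq_neg_pow hpq) _ g₀ g₁ g₂ g₃ a' a b' b

theorem intertwines_left₂ {q : ℂ} (hφ : LeftTwo φ) (hq : q ≠ 0)
    (hpq : h = Complex.I * q) (hn : 2 ≤ n) :
    Intertwines PowerSeries.X (qPow q 1 (-(site n 1 Hm + site n 2 Hm))) (site₂ n 1 Xm Xm)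
      (qPow q (-1) (-(site n 1 Hm + site n 2 Hm))) (layerR n φ) := by
  rw [qPow_one_neg_site_add hq le_rfl hn, qPow_neg_neg_site_add hq le_rfl hn, site₂_eq_tens]
  refine layerR_intertwines₂ φ le_rfl hn _ _ _ _ _ _ _ fun P S hP _ a' a b' b => ?_
  rw [hP rfl]
  simp only [one_mul, ← postcomp_apply]
  have g₁ : ∀ O, postcomp φ S (osc _ .ap * O) = PowerSeries.X * postcomp φ S (osc _ .am * O) := by
    intro O
    simpa only [postcomp_apply, mul_assoc] using hφ (O * S)
  refine local_left₂ (cpow_half_ne_zero hq) (sq_eq_neg_pow hpq) _ _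
    (by simpa using g₁ 1) (g₁ _) ?_ ?_ a' a b' b
  · rw [g₁, osc_am_ap, map_sub, map_smul, pow_two (osc _ _), mul_sub, mul_smul_comm]
  · rw [← g₁, osc_ap_am, map_sub, map_smul, pow_two (osc _ _)]

theorem site_Hm_succ_eq_diagonal (k : Fin n) :
    site n (k + 1) Hm = Matrix.diagonal fun α => Hm (α k) (α k) := by
  rw [site_Hm_eq_diagonal n _ (by omega) k.isLt]
  congr 1
  funext α
  simp [← Fin.ext_iff]

/-- The sum of the weights of the two factors at position `k`. -/
def pairWeight (k : Fin n) (a : Lab n × Lab n) : ℂ :=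
  Hm (a.1 k) (a.1 k) + Hm (a.2 k) (a.2 k)

theorem pairWeight_swap (k : Fin n) (a : Lab n × Lab n) : pairWeight k a.swap = pairWeight k a :=
  add_comm _ _

theorem coprodH_site (k : Fin n) :
    coprodH (site n (k + 1) Hm) = Matrix.diagonal (pairWeight k) := by
  rw [site_Hm_succ_eq_diagonal]
  ext a' a
  rcases a' with ⟨a₁', a₂'⟩
  rcases a with ⟨a₁, a₂⟩
  by_cases h₁ : a₁' = a₁ <;> by_cases h₂ : a₂' = a₂ <;>
    simp [coprodH, h₁, h₂, pairWeight]

theorem preservesWeight_site_iff {K : Type} [CommRing K] [Algebra ℂ K] (k : Fin n)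
    (R : Matrix (Lab n × Lab n) (Lab n × Lab n) K) :
    PreservesWeight (site n (k + 1) Hm) R ↔ ∀ a' a, check R a' a * algebraMap ℂ K (pairWeight k a) =
      algebraMap ℂ K (pairWeight k a') * check R a' a := by
  have : baseChange K (coprodH (site n (k + 1) Hm)) =
      Matrix.diagonal fun a => algebraMap ℂ K (pairWeight k a) := by
    rw [coprodH_site, baseChange, Matrix.diagonal_map (map_zero _)]
  rw [PreservesWeight, this, ← Matrix.ext_iff]
  simp only [Matrix.mul_diagonal, Matrix.diagonal_mul]

/-- Each nonzero entry of the `L` operator conserves α + β. One position that violates this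
contributes a zero factor and kills the whole product. -/
theorem preservesWeight_site (φ : Osc (h ^ 2) →ₗ[ℂ] PowerSeries ℂ) {i : ℕ} (hi : 1 ≤ i)
    (hin : i ≤ n) : PreservesWeight (site n i Hm) (layerR n φ) := by
  have hL : ∀ a' a : Fin 2 × Fin 2, Hm a'.1 a'.1 + Hm a'.2 a'.2 ≠ Hm a.1 a.1 + Hm a.2 a.2 →
      Lmat (h ^ 2) a' a = 0 := by
    simp only [Prod.forall, Fin.forall_fin_two]
    simp [Lmat, Lop, Hm]
  obtain ⟨k, rfl⟩ : ∃ k : Fin n, i = k + 1 := ⟨⟨i - 1, by omega⟩, by simp; omega⟩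
  rw [preservesWeight_site_iff]
  intro a' a
  by_cases hw : pairWeight k a' = pairWeight k a
  · rw [hw, mul_comm]
  · have : check (layerR n φ) a' a = 0 := by
      have h₀ : layer n (fun _ => Lmat (h ^ 2)) a'.swap a = 0 := by
        refine List.prod_eq_zero ?_
        rw [List.mem_ofFn]
        refine ⟨k, hL _ _ ?_⟩
        rw [← pairWeight_swap] at hw
        exact hw
      exact (congrArg φ h₀).trans (map_zero φ)
    rw [this, zero_mul, mul_zero]

theorem PreservesWeight.neg {A : Matrix (Lab n) (Lab n) ℂ} {K : Type} [CommRing K] [Algebra ℂ K]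
    {R : Matrix (Lab n × Lab n) (Lab n × Lab n) K} (hA : PreservesWeight A R) :
    PreservesWeight (-A) R := by
  simpa using hA.smul (-1)

theorem Intertwines.neg {D X D' : Matrix (Lab n) (Lab n) ℂ} {K : Type} [CommRing K] [Algebra ℂ K]
    {ξ : K} {R : Matrix (Lab n × Lab n) (Lab n × Lab n) K} (hX : Intertwines ξ D X D' R) :
    Intertwines ξ D (-X) D' R := by
  simpa using hX.smul (-1)

/-- The layer matrices satisfy the linear conditions on the quantum `R` matrix. -/
theorem layerR_isIntertwiner {T : AffineType} {q : ℂ} (hφ : Boundary φ T) (hn : minRank T ≤ n)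
    (hh : h ≠ 0) (hq : q ≠ 0) (hpq : h = Complex.I * q) :
    IsIntertwiner T n q PowerSeries.X (layerR n φ) := by
  have hn₁ : 1 ≤ n := by cases T <;> simp only [minRank] at hn <;> omega
  have hlast : ∀ X : Matrix (Fin 2) (Fin 2) ℂ, X = Xp ∨ X = Xm → T ≠ .D1 →
      Intertwines 1 (qPow q 1 (site n n Hm)) ((csqrt (q + q⁻¹))⁻¹ • site n n X)
        (qPow q (-1) (site n n Hm)) (layerR n φ) := by
    intro X hX hT
    refine Intertwines.smul ?_ _
    cases T
    · exact intertwines_right₁ hφ.2 hq hpq hn₁ hX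
    · exact intertwines_right₁ hφ.2 hq hpq hn₁ hX
    · exact absurd rfl hT
  refine ⟨fun i hi hin => ?_, fun i hi hin => ?_, fun i hi hin => ?_, ?_⟩
  · have hi₀ : i ≠ 0 := by omega
    rcases hin.lt_or_eq with hin' | rfl
    · simp only [chevX, chevH, hi₀, hin', if_true, if_false]
      exact (intertwines_bulk φ hq hpq hi hin').neg
    · simp only [chevX, chevH, hi₀, lt_irrefl, if_false]
      cases T
      · exact hlast Xp (.inl rfl) (by simp)
      · exact hlast Xp (.inl rfl) (by simp)
      · obtain ⟨m, rfl⟩ : ∃ m, i = m + 1 := ⟨i - 1, by omega⟩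
        simp only [minRank] at hn
        exact (intertwines_right₂ hφ.2 hh hq hpq (by omega) rfl (.inl rfl)).neg
  · have hi₀ : i ≠ 0 := by omega
    rcases hin.lt_or_eq with hin' | rfl
    · simp only [chevX, chevH, hi₀, hin', if_true, if_false, Matrix.transpose_neg, transpose_site₂,
        transpose_Xp, transpose_Xm]
      exact (intertwines_bulk_transpose φ hq hpq hi hin').neg
    · simp only [chevX, chevH, hi₀, lt_irrefl, if_false]
      cases T
      · simp only [Matrix.transpose_smul, transpose_site, transpose_Xp]
        exact hlast Xm (.inr rfl) (by simp)
      · simp only [Matrix.transpose_smul, transpose_site, transpose_Xp]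
        exact hlast Xm (.inr rfl) (by simp)
      · obtain ⟨m, rfl⟩ : ∃ m, i = m + 1 := ⟨i - 1, by omega⟩
        simp only [minRank] at hn
        simp only [Matrix.transpose_neg, transpose_site₂, transpose_Xp]
        exact (intertwines_right₂ hφ.2 hh hq hpq (by omega) rfl (.inr rfl)).neg
  · have hi₀ : i ≠ 0 := by omega
    rcases hin.lt_or_eq with hin' | rfl
    · simp only [chevH, hi₀, hin', if_true, if_false, sub_eq_add_neg]
      exact (preservesWeight_site φ hi hin).add (preservesWeight_site φ (by omega) hin').neg
    · simp only [chevH, hi₀, lt_irrefl, if_false]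
      cases T
      · exact preservesWeight_site φ hi le_rfl
      · exact preservesWeight_site φ hi le_rfl
      · simp only [minRank] at hn
        exact (preservesWeight_site φ (by omega) (by omega)).add (preservesWeight_site φ hi le_rfl)
  · simp only [chevX, chevH, if_true]
    cases T
    · exact (intertwines_left₂ hφ.1 hq hpq hn).neg
    · exact ((intertwines_left₁ hφ.1 hq hpq hn₁).smul _).neg
    · simp only [minRank] at hn
      exact (intertwines_left₂ hφ.1 hq hpq (by omega)).neg

end Boundary

/-! ## The boundary vectors satisfy the boundary conditions -/

section Sandwich

variable {h : ℂ} (hh : h ≠ 0)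

/-- The product of the first `N` matrix elements of `a⁺`. -/
def apProd (h : ℂ) (N : ℕ) : ℂ := ∏ i ∈ Finset.range N, csqrt (1 - (h ^ 2) ^ (2 * i + 2))

theorem apProd_succ (h : ℂ) (N : ℕ) :
    apProd h (N + 1) = apProd h N * csqrt (1 - (h ^ 2) ^ (2 * N + 2)) :=
  Finset.prod_range_succ _ _

theorem apProd_succ_mul (h : ℂ) (N : ℕ) :
    apProd h (N + 1) * csqrt (1 - (h ^ 2) ^ (2 * N + 2)) =
      apProd h N * (1 - (h ^ 2) ^ (2 * N + 2)) := by
  rw [apProd_succ, mul_assoc, csqrt_mul_self]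

theorem fock_ap : fock h hh (osc _ .ap) = fockAp h := oscLift_osc _ _ _ _ _ _

theorem fock_am : fock h hh (osc _ .am) = fockAm h := oscLift_osc _ _ _ _ _ _

theorem fock_kk : fock h hh (osc _ .kk) = fockK h := oscLift_osc _ _ _ _ _ _

theorem fockAp_pow_vac (N : ℕ) : (fockAp h ^ N) vac = Pi.single N (apProd h N) := by
  induction N with
  | zero => simp [apProd, vac]
  | succ N ih =>
    rw [pow_succ', Module.End.mul_apply, ih]
    funext m
    rcases m with _ | m
    · simp [fockAp]
    · by_cases hm : m = N
      · subst hm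
        simp [fockAp, apProd_succ, mul_comm]
      · simp [fockAp, hm]

theorem fockAm_pow_apply_zero (N : ℕ) (g : ℕ → ℂ) : (fockAm h ^ N) g 0 = apProd h N * g N := by
  induction N generalizing g with
  | zero => simp [apProd]
  | succ N ih =>
    rw [pow_succ, Module.End.mul_apply, ih, apProd_succ]
    simp [fockAm, mul_add, mul_assoc]

/-- ⟨0|(a⁻)^N is a multiple of ⟨N|, so the coefficient of x^j sees only the component along |sj⟩. -/
theorem coeff_sandwich (s t j : ℕ) (O : Osc (h ^ 2)) :
    PowerSeries.coeff j (sandwich h hh s t O) =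
      invQCoeff ((h ^ 2) ^ (s ^ 2)) j * (apProd h (s * j) * fock h hh O (ket h hh t 1) (s * j)) := by
  rw [sandwich, PowerSeries.coeff_mk, map_mul, map_pow, fock_am, Module.End.mul_apply,
    fockAm_pow_apply_zero]

theorem ket_apply {t : ℕ} (ht : 0 < t) (m : ℕ) :
    ket h hh t 1 m =
      if t ∣ m then invQCoeff ((h ^ 2) ^ (t ^ 2)) (m / t) * apProd h m else 0 := by
  simp only [ket, map_pow, fock_ap, fockAp_pow_vac, one_pow, mul_one]
  split_ifs with hd
  · obtain ⟨j, rfl⟩ := hd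
    rw [Nat.mul_div_cancel_left _ ht, Finset.sum_eq_single j]
    · simp
    · intro k _ hk
      rw [Pi.single_eq_of_ne, mul_zero]
      intro h'
      exact hk (Nat.eq_of_mul_eq_mul_left ht h').symm
    · intro hj
      exact absurd (Finset.mem_range.mpr (Nat.lt_succ_of_le (Nat.le_mul_of_pos_left j ht))) hj
  · refine Finset.sum_eq_zero fun k _ => ?_
    rw [Pi.single_eq_of_ne, mul_zero]
    rintro rfl
    exact hd (dvd_mul_right _ _)

/-- The recursion behind all boundary relations. It requires that `b` is not a root of unity, since
otherwise a zero denominator would be inverted to 0. -/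
theorem invQCoeff_succ_mul {b : ℂ} (hb : ∀ m : ℕ, 0 < m → b ^ m ≠ 1) (j : ℕ) :
    invQCoeff b (j + 1) * (1 - b ^ (j + 1)) = invQCoeff b j := by
  have : 1 - b ^ (j + 1) ≠ 0 := sub_ne_zero.mpr (hb _ j.succ_pos).symm
  rw [invQCoeff, invQCoeff, Finset.prod_range_succ, mul_inv, mul_assoc, inv_mul_cancel₀ this,
    mul_one]

/-- `sandwich` as a linear map. -/
def sandwichLin (s t : ℕ) : Osc (h ^ 2) →ₗ[ℂ] PowerSeries ℂ where
  toFun := sandwich h hh s t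
  map_add' A B := by
    ext j
    simp [coeff_sandwich, mul_add]
  map_smul' c A := by
    ext j
    simp [coeff_sandwich, mul_left_comm]

theorem sandwichLin_apply (s t : ℕ) (O : Osc (h ^ 2)) :
    sandwichLin hh s t O = sandwich h hh s t O := rfl

/-- Thus a relation on the ket alone gives the right boundary condition with any operator `O` in
front. -/
theorem sandwich_eq_of_fock_eq (s t : ℕ) (A B : Osc (h ^ 2))
    (hAB : fock h hh A (ket h hh t 1) = fock h hh B (ket h hh t 1)) (O : Osc (h ^ 2)) :
    sandwichLin hh s t (O * A) = sandwichLin hh s t (O * B) := by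
  ext j
  rw [sandwichLin_apply, sandwichLin_apply, coeff_sandwich, coeff_sandwich, map_mul, map_mul,
    Module.End.mul_apply, Module.End.mul_apply, hAB]

/-- With c_m the component of the ket along |m⟩, the relations read √(1 - p^{2m+2}) c_{m+1} = (1 +
p^{m+1}) c_m and √(1 - p^{2m}) c_{m-1} = (1 - p^m) c_m. Both follow from 1 - p^{2m} = (1 - p^m)(1 +
p^m) and the recursion for 1/(p; p)_m. -/
theorem rightOne_sandwich (hp : ∀ m : ℕ, 0 < m → (h ^ 2) ^ m ≠ 1) (s : ℕ) : RightOne (sandwichLin hh s 1) := by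
  have hk : ∀ m, ket h hh 1 1 m = invQCoeff (h ^ 2) m * apProd h m := by
    intro m
    rw [ket_apply hh one_pos, if_pos (one_dvd m)]
    simp
  intro O
  constructor
  · have : fock h hh (osc _ .am) (ket h hh 1 1) =
        fock h hh (1 + h • osc _ .kk) (ket h hh 1 1) := by
      funext m
      simp only [fock_am, map_add, map_one, map_smul, fock_kk, fockAm, fockK, LinearMap.coe_mk,
        AddHom.coe_mk, LinearMap.add_apply, LinearMap.smul_apply, Module.End.one_apply,
        Pi.add_apply, Pi.smul_apply, smul_eq_mul, hk]
      linear_combination invQCoeff (h ^ 2) (m + 1) * apProd_succ_mul h m +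
        apProd h m * (1 + (h ^ 2) ^ (m + 1)) * invQCoeff_succ_mul hp m
    rw [sandwich_eq_of_fock_eq hh s 1 _ _ this O, mul_add, mul_one, map_add, mul_smul_comm, map_smul]
  · have : fock h hh (osc _ .ap) (ket h hh 1 1) =
        fock h hh (1 - h⁻¹ • osc _ .kk) (ket h hh 1 1) := by
      funext m
      simp only [fock_ap, map_sub, map_one, map_smul, fock_kk, fockAp, fockK, LinearMap.coe_mk,
        AddHom.coe_mk, LinearMap.sub_apply, LinearMap.smul_apply, Module.End.one_apply,
        Pi.sub_apply, Pi.smul_apply, smul_eq_mul, hk]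
      rcases m with _ | m
      · field_simp
        simp
      · simp only [apProd_succ, ← invQCoeff_succ_mul hp m]
        field_simp
        ring
    rw [sandwich_eq_of_fock_eq hh s 1 _ _ this O, mul_sub, mul_one, map_sub, mul_smul_comm, map_smul]

/-- The ket has even components only, so both sides live on odd m. At m = 2j + 1 the matrix elements
of a⁻ produce the factor 1 - p^{4(j+1)}, which the base p⁴ of the q-exponential cancels. -/
theorem rightTwo_sandwich (hp : ∀ m : ℕ, 0 < m → (h ^ 2) ^ m ≠ 1) (s : ℕ) : RightTwo (sandwichLin hh s 2) := by
  intro O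
  refine sandwich_eq_of_fock_eq hh s 2 _ _ ?_ O
  have hp' : ∀ m : ℕ, 0 < m → ((h ^ 2) ^ (2 ^ 2)) ^ m ≠ 1 := by
    intro m hm
    rw [← pow_mul]
    exact hp _ (by positivity)
  rw [fock_ap, fock_am]
  have odd : ∀ j, ket h hh 2 1 (2 * j + 1) = 0 := by
    intro j
    rw [ket_apply hh two_pos, if_neg (by omega)]
  have even : ∀ j, ket h hh 2 1 (2 * j) = invQCoeff ((h ^ 2) ^ (2 ^ 2)) j * apProd h (2 * j) := by
    intro j
    rw [ket_apply hh two_pos, if_pos (dvd_mul_right _ _), Nat.mul_div_cancel_left _ two_pos]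
  funext m
  obtain ⟨j, rfl | rfl⟩ := Nat.even_or_odd' m
  · rcases j with _ | j
    · simp [fockAp, fockAm, show ket h hh 2 1 1 = 0 from odd 0]
    · simp only [fockAp, fockAm, LinearMap.coe_mk, AddHom.coe_mk, odd, mul_zero]
      rw [show 2 * (j + 1) = 2 * j + 1 + 1 by ring]
      simp [odd]
  · simp only [fockAp, fockAm, LinearMap.coe_mk, AddHom.coe_mk, even,
      show 2 * j + 1 + 1 = 2 * (j + 1) by ring]
    have e := apProd_succ_mul h (2 * j + 1)
    rw [← invQCoeff_succ_mul hp' j, show 2 * (j + 1) = 2 * j + 1 + 1 by ring]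
    rw [show 2 * (2 * j + 1 + 1) = 2 * (2 * j + 1) + 2 by ring]
    have e' := apProd_succ h (2 * j)
    linear_combination (-invQCoeff ((h ^ 2) ^ (2 ^ 2)) (j + 1)) * e -
      invQCoeff ((h ^ 2) ^ (2 ^ 2)) (j + 1) * (1 - (h ^ 2) ^ (2 * (2 * j + 1) + 2)) * e'

/-- The recursions are those of the ket, read coefficientwise in x: raising the Fock level by one
corresponds to multiplication by x. -/
theorem leftOne_sandwich (hp : ∀ m : ℕ, 0 < m → (h ^ 2) ^ m ≠ 1) (t : ℕ) : LeftOne (sandwichLin hh 1 t) := by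
  intro O
  constructor
  · ext j
    rcases j with _ | j
    -- The constant term vanishes because ⟨0|a⁺ = 0.
    · simp [sandwichLin_apply, coeff_sandwich, fock_ap, fockAp]
    · simp only [map_add, PowerSeries.coeff_succ_X_mul, PowerSeries.coeff_smul, sandwichLin_apply,
        coeff_sandwich, map_mul, fock_ap, fock_kk, Module.End.mul_apply, one_pow, pow_one, one_mul]
      simp only [fockAp, fockK, LinearMap.coe_mk, AddHom.coe_mk, smul_eq_mul]
      linear_combination invQCoeff (h ^ 2) (j + 1) * fock h hh O (ket h hh t 1) j *
        apProd_succ_mul h j + fock h hh O (ket h hh t 1) j *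
        apProd h j * (1 + (h ^ 2) ^ (j + 1)) * invQCoeff_succ_mul hp j
  · ext j
    rcases j with _ | j
    · simp only [map_sub, PowerSeries.coeff_zero_X_mul, PowerSeries.coeff_smul, sandwichLin_apply,
        coeff_sandwich, map_mul, fock_kk, Module.End.mul_apply, one_pow, pow_one]
      simp only [fockK, LinearMap.coe_mk, AddHom.coe_mk]
      -- On the vacuum k equals h, so ⟨0|(1 - h⁻¹k) = 0.
      linear_combination (invQCoeff (h ^ 2) 0 * (apProd h (1 * 0) *
        fock h hh O (ket h hh t 1) (1 * 0))) * inv_mul_cancel₀ hh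
    · simp only [map_sub, PowerSeries.coeff_succ_X_mul, PowerSeries.coeff_smul, sandwichLin_apply,
        coeff_sandwich, map_mul, fock_am, fock_kk, Module.End.mul_apply, one_pow, pow_one, one_mul]
      simp only [fockAm, fockK, LinearMap.coe_mk, AddHom.coe_mk, smul_eq_mul]
      simp only [apProd_succ, ← invQCoeff_succ_mul hp j]
      field_simp
      ring_nf

theorem leftTwo_sandwich (hp : ∀ m : ℕ, 0 < m → (h ^ 2) ^ m ≠ 1) (t : ℕ) : LeftTwo (sandwichLin hh 2 t) := by
  intro O
  have hp' : ∀ m : ℕ, 0 < m → ((h ^ 2) ^ (2 ^ 2)) ^ m ≠ 1 := by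
    intro m hm
    rw [← pow_mul]
    exact hp _ (by positivity)
  ext j
  rcases j with _ | j
  · simp [sandwichLin_apply, coeff_sandwich, fock_ap, fockAp]
  · simp only [PowerSeries.coeff_succ_X_mul, sandwichLin_apply,
        coeff_sandwich, map_mul, fock_ap, fock_am, Module.End.mul_apply]
    rw [show 2 * (j + 1) = 2 * j + 1 + 1 by ring]
    simp only [fockAp, fockAm, LinearMap.coe_mk, AddHom.coe_mk]
    have e := apProd_succ_mul h (2 * j + 1)
    have e' := apProd_succ h (2 * j)
    rw [show 2 * (2 * j + 1) = 2 * (2 * j) + 2 by ring] at *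
    rw [← invQCoeff_succ_mul hp' j]
    linear_combination invQCoeff ((h ^ 2) ^ (2 ^ 2)) (j + 1) *
      fock h hh O (ket h hh t 1) (2 * j + 1) * e + invQCoeff ((h ^ 2) ^ (2 ^ 2)) (j + 1) *
      fock h hh O (ket h hh t 1) (2 * j + 1) * (1 - (h ^ 2) ^ (2 * (2 * j) + 2 + 2)) * e'

/-- Boundary conditions are linear over ℂ[[x]], so dividing by the normalizing series preserves
them. -/
theorem Boundary.mulRight {φ : Osc (h ^ 2) →ₗ[ℂ] PowerSeries ℂ} {T : AffineType}
    (hφ : Boundary φ T) (c : PowerSeries ℂ) : Boundary (LinearMap.mulRight ℂ c ∘ₗ φ) T := by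
  have r₁ : RightOne φ → RightOne (LinearMap.mulRight ℂ c ∘ₗ φ) := fun hr O => by
    simp only [LinearMap.comp_apply, LinearMap.mulRight_apply, (hr O).1, (hr O).2, add_mul, sub_mul,
      smul_mul_assoc, and_self]
  have r₂ : RightTwo φ → RightTwo (LinearMap.mulRight ℂ c ∘ₗ φ) := fun hr O => by
    simp only [LinearMap.comp_apply, hr O]
  have l₁ : LeftOne φ → LeftOne (LinearMap.mulRight ℂ c ∘ₗ φ) := fun hl O => by
    simp only [LinearMap.comp_apply, LinearMap.mulRight_apply, ← mul_assoc, (hl O).1, (hl O).2,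
      add_mul, sub_mul, smul_mul_assoc, and_self]
  have l₂ : LeftTwo φ → LeftTwo (LinearMap.mulRight ℂ c ∘ₗ φ) := fun hl O => by
    simp only [LinearMap.comp_apply, LinearMap.mulRight_apply, ← mul_assoc, hl O]
  cases T
  · exact ⟨l₂ hφ.1, r₁ hφ.2⟩
  · exact ⟨l₁ hφ.1, r₁ hφ.2⟩
  · exact ⟨l₂ hφ.1, r₂ hφ.2⟩

/-! ### Parity splitting for type D^{(1)}. -/

/-- The projection `proj p 1 ε` as a linear map. -/
def projLin (p ε : ℂ) : Osc p →ₗ[ℂ] Osc p where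
  toFun := proj p 1 ε
  map_add' A B := by
    simp only [proj, map_add]
    module
  map_smul' c A := by
    simp only [proj, map_smul, RingHom.id_apply]
    module

theorem sigma₁_osc (p : ℂ) {g : OscGen} (hg : g = .ap ∨ g = .am) :
    sigma₁ p (osc p g) = -osc p g := by
  rcases hg with rfl | rfl <;> exact oscLift_osc _ _ _ _ _ _

theorem sigma₂_osc (p : ℂ) {g : OscGen} (hg : g = .ap ∨ g = .am) :
    sigma₂ p (osc p g) = osc p g := by
  rcases hg with rfl | rfl <;> exact oscLift_osc _ _ _ _ _ _

theorem proj_mul_osc (p ε : ℂ) {g : OscGen} (hg : g = .ap ∨ g = .am) (O : Osc p) :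
    proj p 1 ε (O * osc p g) = proj p (-1) ε O * osc p g := by
  simp only [proj, map_mul, sigma₁_osc p hg, sigma₂_osc p hg, smul_mul_assoc, add_mul, mul_neg]
  module

theorem proj_osc_mul (p ε : ℂ) {g : OscGen} (hg : g = .ap ∨ g = .am) (O : Osc p) :
    proj p 1 ε (osc p g * O) = osc p g * proj p (-1) ε O := by
  simp only [proj, map_mul, sigma₁_osc p hg, sigma₂_osc p hg, mul_smul_comm, mul_add, neg_mul]
  module

/-- The conditions of this type involve a^± only, and multiplication by a^± never changes the parity
in k. The even and odd parts in k satisfy them separately, which is why they may carry different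
normalizations. -/
theorem boundary_sandwich_projLin (hp : ∀ m : ℕ, 0 < m → (h ^ 2) ^ m ≠ 1) (ε : ℂ) :
    Boundary (sandwichLin hh 2 2 ∘ₗ projLin (h ^ 2) ε) .D1 := by
  refine ⟨fun O => ?_, fun O => ?_⟩
  · change sandwichLin hh 2 2 (proj _ 1 ε _) = _ * sandwichLin hh 2 2 (proj _ 1 ε _)
    rw [proj_osc_mul _ _ (.inl rfl), proj_osc_mul _ _ (.inr rfl), leftTwo_sandwich hh hp 2]
  · change sandwichLin hh 2 2 (proj _ 1 ε _) = sandwichLin hh 2 2 (proj _ 1 ε _)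
    rw [proj_mul_osc _ _ (.inl rfl), proj_mul_osc _ _ (.inr rfl), rightTwo_sandwich hh hp 2]

/-- The linear form that defines `calR`. -/
def bracketLin : AffineType → Osc (h ^ 2) →ₗ[ℂ] PowerSeries ℂ
  | .B1 => LinearMap.mulRight ℂ (sandwich h hh 2 1 1)⁻¹ ∘ₗ sandwichLin hh 2 1
  | .D2 => LinearMap.mulRight ℂ (sandwich h hh 1 1 1)⁻¹ ∘ₗ sandwichLin hh 1 1
  | .D1 => LinearMap.mulRight ℂ (sandwich h hh 2 2 1)⁻¹ ∘ₗ sandwichLin hh 2 2 ∘ₗ projLin (h ^ 2) 1 +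
      LinearMap.mulRight ℂ (sandwich h hh 2 2 (-Complex.I • osc (h ^ 2) .kk))⁻¹ ∘ₗ
        sandwichLin hh 2 2 ∘ₗ projLin (h ^ 2) (-1)

theorem calR_eq_layerR (T : AffineType) (n : ℕ) : calR T n h hh = layerR n (bracketLin hh T) := by
  cases T <;> rfl

theorem boundary_bracketLin (hp : ∀ m : ℕ, 0 < m → (h ^ 2) ^ m ≠ 1) (T : AffineType) :
    Boundary (bracketLin hh T) T := by
  cases T
  · exact Boundary.mulRight (T := .B1) ⟨leftTwo_sandwich hh hp 1, rightOne_sandwich hh hp 2⟩ _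
  · exact Boundary.mulRight (T := .D2) ⟨leftOne_sandwich hh hp 1, rightOne_sandwich hh hp 1⟩ _
  · obtain ⟨a₁, a₂⟩ := (boundary_sandwich_projLin hh hp 1).mulRight (sandwich h hh 2 2 1)⁻¹
    obtain ⟨b₁, b₂⟩ := (boundary_sandwich_projLin hh hp (-1)).mulRight
      (sandwich h hh 2 2 (-Complex.I • osc (h ^ 2) .kk))⁻¹
    refine ⟨fun O => ?_, fun O => ?_⟩
    · rw [bracketLin, LinearMap.add_apply, LinearMap.add_apply, a₁ O, b₁ O, mul_add]
    · rw [bracketLin, LinearMap.add_apply, LinearMap.add_apply, a₂ O, b₂ O]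

/-! ### Normalization and parity of the layer matrices. -/

/-- The normalization conditions with the value `c` instead of `1`. -/
def NormalizedAt {n : ℕ} {K : Type} [Zero K] (T : AffineType)
    (R : Matrix (Lab n × Lab n) (Lab n × Lab n) K) (c : K) : Prop :=
  match T with
  | .D1 => ParityPreserving R ∧
      ∀ α β : Fin 2, R (lastLab n α, lastLab n β) (lastLab n α, lastLab n β) = c
  | _ => R (0, 0) (0, 0) = c

theorem map_ofFn_prod {p : ℂ} (σ : Osc p →ₐ[ℂ] Osc p) {n : ℕ} (f : Fin n → Osc p) (c : Fin n → ℂ)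
    (hf : ∀ j, σ (f j) = c j • f j) :
    σ (List.ofFn f).prod = (∏ j, c j) • (List.ofFn f).prod := by
  induction n with
  | zero => simp
  | succ n ih =>
    rw [List.ofFn_succ, List.prod_cons, map_mul, hf, ih _ (fun j => c j.succ) fun j => hf _,
      smul_mul_smul_comm, Fin.prod_univ_succ]

theorem sigma₁_kk (p : ℂ) : sigma₁ p (osc p .kk) = osc p .kk := oscLift_osc _ _ _ _ _ _

theorem sigma₂_kk (p : ℂ) : sigma₂ p (osc p .kk) = -osc p .kk := oscLift_osc _ _ _ _ _ _

/-- The entries a^± flip both labels and the other nonzero entries flip neither, so the sign can be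
read off in either tensor factor. -/
theorem sigma₁_Lmat (p : ℂ) (a' a : Fin 2 × Fin 2) :
    sigma₁ p (Lmat p a' a) = (-1 : ℂ) ^ ((a'.1 : ℕ) + a.1) • Lmat p a' a ∧
      sigma₁ p (Lmat p a' a) = (-1 : ℂ) ^ ((a'.2 : ℕ) + a.2) • Lmat p a' a := by
  have h₁ := sigma₁_osc p (g := .ap) (.inl rfl)
  have h₂ := sigma₁_osc p (g := .am) (.inr rfl)
  have h₃ := sigma₁_kk p
  revert a' a
  simp only [Prod.forall, Fin.forall_fin_two]
  simp [Lmat, Lop, h₁, h₂, h₃]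

theorem exists_sigma₂_Lmat (p : ℂ) (a' a : Fin 2 × Fin 2) :
    ∃ d : ℂ, sigma₂ p (Lmat p a' a) = d • Lmat p a' a := by
  have h₁ := sigma₂_osc p (g := .ap) (.inl rfl)
  have h₂ := sigma₂_osc p (g := .am) (.inr rfl)
  have h₃ := sigma₂_kk p
  by_cases hd : a' = a ∧ a.1 ≠ a.2
  · refine ⟨-1, ?_⟩
    obtain ⟨rfl, hd⟩ := hd
    simp [Lmat, Lop, hd, h₃]
  · refine ⟨1, ?_⟩
    revert a' a
    simp only [Prod.forall, Fin.forall_fin_two]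
    simp [Lmat, Lop, h₁, h₂]

theorem prod_neg_one_pow {n : ℕ} (α β : Lab n) (hαβ : parity α ≠ parity β) :
    ∏ j, (-1 : ℂ) ^ ((α j : ℕ) + β j) = -1 := by
  have : ∏ j, (-1 : ℂ) ^ ((α j : ℕ) + β j) = ((parity α * parity β : ℤ) : ℂ) := by
    simp [parity, pow_add, Finset.prod_mul_distrib, Finset.prod_pow_eq_pow_sum]
  rw [this]
  rcases neg_one_pow_eq_or ℤ (∑ j, (α j : ℕ)) with h₁ | h₁ <;>
    rcases neg_one_pow_eq_or ℤ (∑ j, (β j : ℕ)) with h₂ | h₂ <;>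
    simp [parity, h₁, h₂] at hαβ ⊢

/-- An entry that changes the parity of a label is odd in a^±, and averaging over σ₁ kills it. -/
theorem proj_layer_eq_zero (p ε : ℂ) {n : ℕ} (a' a : Lab n × Lab n)
    (hpar : parity a'.1 ≠ parity a.1 ∨ parity a'.2 ≠ parity a.2) :
    proj p 1 ε (layer n (fun _ => Lmat p) a' a) = 0 := by
  have h₁ : sigma₁ p (layer n (fun _ => Lmat p) a' a) = -layer n (fun _ => Lmat p) a' a := by
    rcases hpar with hpar | hpar
    · have := map_ofFn_prod (sigma₁ p) _ _ fun j : Fin n =>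
        (sigma₁_Lmat p (a'.1 j, a'.2 j) (a.1 j, a.2 j)).1
      rw [prod_neg_one_pow _ _ hpar, neg_one_smul] at this
      exact this
    · have := map_ofFn_prod (sigma₁ p) _ _ fun j : Fin n =>
        (sigma₁_Lmat p (a'.1 j, a'.2 j) (a.1 j, a.2 j)).2
      rw [prod_neg_one_pow _ _ hpar, neg_one_smul] at this
      exact this
  obtain ⟨d, h₂⟩ : ∃ d : ℂ, sigma₂ p (layer n (fun _ => Lmat p) a' a) =
      d • layer n (fun _ => Lmat p) a' a := by
    choose d hd using fun j : Fin n => exists_sigma₂_Lmat p (a'.1 j, a'.2 j) (a.1 j, a.2 j)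
    exact ⟨_, map_ofFn_prod (sigma₂ p) _ d hd⟩
  rw [proj, h₂, map_smul, h₁]
  module

theorem layer_diag_of_forall (p : ℂ) {n : ℕ} (a : Lab n × Lab n) (ha : ∀ j, a.1 j = a.2 j) :
    layer n (fun _ => Lmat p) a a = 1 := by
  simp [layer, Lmat, Lop, ha]

/-- The labels differ only at the last position, which contributes the single -ik. This is the
denominator chosen for the part of the linear form that is odd in k. -/
theorem layer_diag_lastLab (p : ℂ) {n : ℕ} (hn : 1 ≤ n) {α β : Fin 2} (hαβ : α ≠ β) :
    layer n (fun _ => Lmat p) (lastLab n α, lastLab n β) (lastLab n α, lastLab n β) =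
      -Complex.I • osc p .kk := by
  obtain ⟨m, rfl⟩ : ∃ m, n = m + 1 := ⟨n - 1, by omega⟩
  have : ∀ j : Fin m, (j : ℕ) ≠ m := fun j => j.isLt.ne
  rw [layer, Matrix.of_apply, List.ofFn_succ']
  simp [Lmat, Lop, lastLab, hαβ, this]

theorem calR_normalizedAt {T : AffineType} {n : ℕ} (hn : 1 ≤ n) :
    NormalizedAt T (calR T n h hh) 1 := by
  have hone : ∀ s t, sandwich h hh s t 1 * (sandwich h hh s t 1)⁻¹ = 1 := fun s t =>
    PowerSeries.mul_inv_cancel _ (by simp [constantCoeff_sandwich_one])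
  have hk : ∀ s t, sandwich h hh s t (-Complex.I • osc (h ^ 2) .kk) *
      (sandwich h hh s t (-Complex.I • osc (h ^ 2) .kk))⁻¹ = 1 := fun s t =>
    PowerSeries.mul_inv_cancel _ (by rw [constantCoeff_sandwich_k]; simp [hh])
  have hz : layer n (fun _ => Lmat (h ^ 2)) ((0, 0) : Lab n × Lab n) (0, 0) = 1 :=
    layer_diag_of_forall _ _ fun _ => rfl
  cases T
  · change calR .B1 n h hh (0, 0) (0, 0) = 1
    rw [calR_eq_layerR, layerR_apply, hz]
    exact hone 2 1
  · change calR .D2 n h hh (0, 0) (0, 0) = 1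
    rw [calR_eq_layerR, layerR_apply, hz]
    exact hone 1 1
  · refine ⟨fun a' a hpar => ?_, fun α β => ?_⟩
    · rw [calR_eq_layerR, layerR_apply]
      simp [bracketLin, projLin, proj_layer_eq_zero _ _ _ _ hpar]
    · rw [calR_eq_layerR, layerR_apply]
      by_cases hαβ : α = β
      · subst hαβ
        rw [layer_diag_of_forall _ _ fun _ => rfl]
        have e₁ : proj (h ^ 2) 1 1 1 = 1 := by
          simp only [proj, map_one]
          module
        have e₂ : proj (h ^ 2) 1 (-1) 1 = 0 := by
          simp only [proj, map_one]
          module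
        rw [bracketLin, LinearMap.add_apply]
        change sandwichLin hh 2 2 (proj (h ^ 2) 1 1 _) * _ +
          sandwichLin hh 2 2 (proj (h ^ 2) 1 (-1) _) * _ = 1
        rw [e₁, e₂, map_zero, zero_mul, add_zero]
        exact hone 2 2
      · rw [layer_diag_lastLab _ hn hαβ]
        have e₁ : proj (h ^ 2) 1 1 (-Complex.I • osc (h ^ 2) .kk) = 0 := by
          simp only [proj, map_smul, sigma₁_kk, sigma₂_kk, map_neg]
          module
        have e₂ : proj (h ^ 2) 1 (-1) (-Complex.I • osc (h ^ 2) .kk) =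
            -Complex.I • osc (h ^ 2) .kk := by
          simp only [proj, map_smul, sigma₁_kk, sigma₂_kk, map_neg]
          module
        rw [bracketLin, LinearMap.add_apply]
        change sandwichLin hh 2 2 (proj (h ^ 2) 1 1 _) * _ +
          sandwichLin hh 2 2 (proj (h ^ 2) 1 (-1) _) * _ = 1
        rw [e₁, e₂, map_zero, zero_mul, zero_add]
        exact hk 2 2

end Sandwich

/-! ## Generating labels by elementary moves -/

section Moves

/-- `β'` arises from `β` by changing the entry at `i` from `u` to `u'`. -/
def Change₁ {n : ℕ} (i : ℕ) (u u' : Fin 2) (β β' : Lab n) : Prop :=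
  ∀ j : Fin n, if (j : ℕ) = i then β j = u ∧ β' j = u' else β' j = β j

/-- `β'` arises from `β` by changing the entries at `i, i + 1` from `u, v` to `u', v'`. -/
def Change₂ {n : ℕ} (i : ℕ) (u v u' v' : Fin 2) (β β' : Lab n) : Prop :=
  ∀ j : Fin n, if (j : ℕ) = i then β j = u ∧ β' j = u'
    else if (j : ℕ) = i + 1 then β j = v ∧ β' j = v' else β' j = β j

/-- The number of entries equal to `1`. -/
def weight {n : ℕ} (β : Lab n) : ℕ := ∑ j, (β j : ℕ)

/-- The label `(1, 0, …, 0)`. -/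
def firstLab (n : ℕ) : Lab n := fun j => if (j : ℕ) = 0 then 1 else 0

theorem weight_snoc {n : ℕ} (γ : Lab n) (b : Fin 2) :
    weight (Fin.snoc γ b : Lab (n + 1)) = weight γ + b := by
  simp [weight, Fin.sum_univ_castSucc]

theorem Change₂.snoc {n i : ℕ} {u v u' v' : Fin 2} {β β' : Lab n} (hi : i + 1 < n)
    (hβ : Change₂ i u v u' v' β β') (b : Fin 2) :
    Change₂ i u v u' v' (Fin.snoc β b : Lab (n + 1)) (Fin.snoc β' b) := by
  intro j
  induction j using Fin.lastCases with
  | last => simp [show n ≠ i by omega, show n ≠ i + 1 by omega]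
  | cast j => simpa using hβ j

/-- A 1 may move to the right, and a pair 11 may be created at the left end. Induction on the
length, according to the last entry: the shorter statement is applied with that entry frozen at 0 or
at 1. -/
theorem forall_lab_of_moves {n : ℕ} (S : Lab (n + 1) → Prop)
    (hmove : ∀ i, i < n → ∀ β β', Change₂ i 1 0 0 1 β β' → S β → S β')
    (hins : 0 < n → ∀ β β', Change₂ 0 0 0 1 1 β β' → S β → S β') :
    (S 0 → ∀ β, Even (weight β) → S β) ∧ (S (firstLab _) → ∀ β, Odd (weight β) → S β) := by
  induction n with
  | zero =>
    have h01 : ∀ b : Fin 2, b = 0 ∨ b = 1 := by decide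
    refine ⟨fun h₀ β hβ => ?_, fun h₁ β hβ => ?_⟩
    · have : β = 0 := by
        funext j
        obtain rfl : j = 0 := Fin.ext (by omega)
        rcases h01 (β 0) with h | h
        · exact h
        · simp [weight, h] at hβ
      rwa [this]
    · have : β = firstLab _ := by
        funext j
        obtain rfl : j = 0 := Fin.ext (by omega)
        rcases h01 (β 0) with h | h
        · simp [weight, h] at hβ
        · simp [h, firstLab]
      rwa [this]
  | succ m ih =>
    have ih' := fun b : Fin 2 => ih (fun γ => S (Fin.snoc γ b : Lab (m + 2)))
      (fun i hi β β' hβ => hmove i (by omega) _ _ (hβ.snoc (by omega) b))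
      (fun hm β β' hβ => hins (by omega) _ _ (hβ.snoc (by omega) b))
    have hsplit : ∀ β : Lab (m + 2), ∃ (γ : Lab (m + 1)) (b : Fin 2),
        β = (Fin.snoc γ b : Lab (m + 2)) := fun β => ⟨Fin.init β, β (Fin.last _), by simp⟩
    have h01 : ∀ b : Fin 2, b = 0 ∨ b = 1 := by decide
    have hlast : ∀ γ γ' : Lab (m + 1), (∀ j : Fin (m + 1), if (j : ℕ) = m then γ j = 1 ∧ γ' j = 0 else γ' j = γ j) →
        S (Fin.snoc γ 0 : Lab (m + 2)) → S (Fin.snoc γ' 1 : Lab (m + 2)) := by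
      intro γ γ' hγ
      refine hmove m (by omega) _ _ fun j => ?_
      induction j using Fin.lastCases with
      | last => simp
      | cast j => simpa [j.isLt.ne] using hγ j
    refine ⟨fun h₀ β hβ => ?_, fun h₁ β hβ => ?_⟩
    · have hz : S (Fin.snoc (0 : Lab (m + 1)) (0 : Fin 2) : Lab (m + 2)) := by
        convert h₀
        funext j
        induction j using Fin.lastCases <;> simp
      obtain ⟨γ, b, rfl⟩ := hsplit β
      rw [weight_snoc] at hβ
      rcases h01 b with rfl | rfl
      · exact (ih' 0).1 hz γ (by simpa using hβ)
      · refine (ih' 1).2 ?_ γ (by simpa [Nat.even_add_one] using hβ)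
        rcases m with _ | m
        -- With two positions the label 11 is created directly; there is no room to move.
        · refine hins (by omega) _ _ (fun j => ?_) h₀
          induction j using Fin.lastCases with
          | last => simp [Fin.snoc]
          | cast j => simp [firstLab]
        -- Put 1s at the first and last positions of the initial segment, an even label with final
        -- entry 0, and push the second 1 into the final position.
        · refine hlast (fun j => if (j : ℕ) = 0 ∨ (j : ℕ) = m + 1 then 1 else 0) _ (fun j => ?_)
            ((ih' 0).1 hz _ ?_)
          · by_cases hj : (j : ℕ) = m + 1 <;> simp [firstLab, hj]
          · rw [weight, Fin.sum_univ_succ, Fin.sum_univ_castSucc]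
            have : ∀ i : Fin m, (i : ℕ) ≠ m := fun i => i.isLt.ne
            simp [this]
    · have hz : S (Fin.snoc (firstLab (m + 1)) (0 : Fin 2) : Lab (m + 2)) := by
        convert h₁
        funext j
        induction j using Fin.lastCases <;> simp [firstLab]
      obtain ⟨γ, b, rfl⟩ := hsplit β
      rw [weight_snoc] at hβ
      rcases h01 b with rfl | rfl
      · exact (ih' 0).2 hz γ (by simpa using hβ)
      · refine (ih' 1).1 ?_ γ (by simpa [Nat.odd_add_one] using hβ)
        refine hlast (fun j => if (j : ℕ) = m then 1 else 0) _ (fun j => ?_) ((ih' 0).2 hz _ ?_)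
        · split_ifs with hj
          · simp
          · simp
        · have : ∀ i : Fin m, (i : ℕ) ≠ m := fun i => i.isLt.ne
          simp [weight, Fin.sum_univ_castSucc, this]

theorem Change₂.rev {n i : ℕ} {u v u' v' : Fin 2} {β β' : Lab (n + 1)} (hi : i < n)
    (hβ : Change₂ i u v u' v' β β') :
    Change₂ (n - 1 - i) v u v' u' (fun j => β j.rev) fun j => β' j.rev := by
  intro j
  have h := hβ j.rev
  rw [Fin.val_rev] at h
  split_ifs at h ⊢ <;> omega

/-- The mirror image: pairs are created at the right end and 1s move to the left. -/
theorem forall_lab_of_moves_rev {n : ℕ} (S : Lab (n + 1) → Prop)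
    (hmove : ∀ i, i < n → ∀ β β', Change₂ i 0 1 1 0 β β' → S β → S β')
    (hins : 0 < n → ∀ β β', Change₂ (n - 1) 0 0 1 1 β β' → S β → S β') :
    (S 0 → ∀ β, Even (weight β) → S β) ∧ (S (lastLab _ 1) → ∀ β, Odd (weight β) → S β) := by
  have key := forall_lab_of_moves (fun β => S fun j => β j.rev)
    (fun i hi β β' hβ => hmove (n - 1 - i) (by omega) _ _ (hβ.rev hi))
    (fun hn β β' hβ => hins hn _ _ (hβ.rev hn))
  have hw : ∀ β : Lab (n + 1), weight (fun j => β j.rev) = weight β := fun β =>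
    Equiv.sum_comp Fin.revPerm fun j => (β j : ℕ)
  refine ⟨fun h₀ β hβ => ?_, fun h₁ β hβ => ?_⟩
  · simpa using key.1 h₀ (fun j => β j.rev) (by rwa [hw])
  · have : lastLab (n + 1) 1 = fun j => firstLab (n + 1) j.rev := by
      funext j
      simp only [lastLab, firstLab, Fin.val_rev]
      exact if_congr (by omega) rfl rfl
    rw [this] at h₁
    simpa using key.2 h₁ (fun j => β j.rev) (by rwa [hw])

end Moves

/-! ## Uniqueness at spectral parameter zero -/

section Uniqueness

variable {n : ℕ}

/-- If each factor sends its basis vector to a basis vector, so does the tensor product. -/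
theorem tens_apply_of_col {f : ℕ → Matrix (Fin 2) (Fin 2) ℂ} {β β' : Lab n}
    (hf : ∀ (j : Fin n) c, f (j + 1) c (β j) = if c = β' j then 1 else 0) (c : Lab n) :
    tens n f c β = if c = β' then 1 else 0 := by
  simp only [tens, Matrix.of_apply, hf]
  split_ifs with hc
  · simp [hc]
  · obtain ⟨j, hj⟩ := Function.ne_iff.mp hc
    exact Finset.prod_eq_zero (Finset.mem_univ j) (if_neg hj)

theorem site_apply_of_change {i : ℕ} {M : Matrix (Fin 2) (Fin 2) ℂ} {u u' : Fin 2} {β β' : Lab n}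
    (hM : ∀ c, M c u = if c = u' then 1 else 0) (hβ : Change₁ i u u' β β') (c : Lab n) :
    site n (i + 1) M c β = if c = β' then 1 else 0 := by
  refine tens_apply_of_col (fun j c => ?_) c
  have := hβ j
  simp only [Nat.add_right_cancel_iff]
  by_cases h₁ : (j : ℕ) = i
  · simp only [h₁, if_true] at this ⊢
    rw [this.1, this.2, hM]
  · simp only [h₁, if_false] at this ⊢
    rw [this, Matrix.one_apply]

theorem site₂_apply_of_change {i : ℕ} {M N : Matrix (Fin 2) (Fin 2) ℂ} {u v u' v' : Fin 2}
    {β β' : Lab n} (hM : ∀ c, M c u = if c = u' then 1 else 0)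
    (hN : ∀ c, N c v = if c = v' then 1 else 0) (hβ : Change₂ i u v u' v' β β') (c : Lab n) :
    site₂ n (i + 1) M N c β = if c = β' then 1 else 0 := by
  refine tens_apply_of_col (fun j c => ?_) c
  have := hβ j
  simp only [Nat.add_right_cancel_iff]
  by_cases h₁ : (j : ℕ) = i
  · simp only [h₁, if_true] at this ⊢
    rw [this.1, this.2, hM]
  · by_cases h₂ : (j : ℕ) = i + 1
    · simp only [h₂, if_true, Nat.succ_ne_self, if_false] at this ⊢
      rw [this.1, this.2, hN]
    · simp only [h₁, h₂, if_false] at this ⊢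
      rw [this, Matrix.one_apply]

theorem site_apply_eq_zero {M : Matrix (Fin 2) (Fin 2) ℂ} (j : Fin n) {β : Lab n}
    (hM : ∀ c, M c (β j) = 0) (c : Lab n) : site n (j + 1) M c β = 0 :=
  Finset.prod_eq_zero (Finset.mem_univ j) (by simp [hM])

theorem site₂_apply_eq_zero {M N : Matrix (Fin 2) (Fin 2) ℂ} (j : Fin n) {β : Lab n}
    (hM : ∀ c, M c (β j) = 0) (c : Lab n) : site₂ n (j + 1) M N c β = 0 :=
  Finset.prod_eq_zero (Finset.mem_univ j) (by simp [hM])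

/-- The column of `Ř` at `b` vanishes. -/
def ColZero (R : Matrix (Lab n × Lab n) (Lab n × Lab n) ℂ) (b : Lab n × Lab n) : Prop :=
  ∀ a', check R a' b = 0

variable {R : Matrix (Lab n × Lab n) (Lab n × Lab n) ℂ} {q ξ : ℂ}
  {X H D' : Matrix (Lab n) (Lab n) ℂ}

/-- The relation applied to v_α ⊗ v_β: the side on which Ř acts first vanishes. -/
theorem Intertwines.sum_eq_zero {D : Matrix (Lab n) (Lab n) ℂ} (hR : Intertwines ξ D X D' R)
    {α β : Lab n} (hz : ColZero R (α, β)) (a' : Lab n × Lab n) :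
    ∑ c : Lab n × Lab n, check R a' c * (D c.1 α * X c.2 β + ξ * (X c.1 α * D' c.2 β)) = 0 := by
  have h₁ := congrFun (congrFun hR a') (α, β)
  have h₂ : ∀ B : Matrix (Lab n × Lab n) (Lab n × Lab n) ℂ, (B * check R) a' (α, β) = 0 := fun B =>
    Finset.sum_eq_zero fun c _ => mul_eq_zero_of_right _ (hz c)
  rw [h₂] at h₁
  simpa [Matrix.mul_apply, baseChange] using h₁

/-- When the term with `X` on the first factor disappears, because `X` kills v_α or because ξ = 0,
what remains is a nonzero multiple of Ř(v_α ⊗ X v_β). -/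
theorem ColZero.snd (hq : q ≠ 0) (hR : Intertwines ξ (qPow q 1 H) X D' R) {α β β' : Lab n}
    (hα : ∀ c, ξ * X c α = 0) {κ : ℂ} (hκ : κ ≠ 0) (hβ : ∀ c, X c β = κ * if c = β' then 1 else 0)
    (hz : ColZero R (α, β)) : ColZero R (α, β') := by
  intro a'
  have h := hR.sum_eq_zero hz a'
  simp only [← mul_assoc ξ, hα, zero_mul, add_zero, hβ, qPow, Matrix.diagonal_apply] at h
  rw [Fintype.sum_eq_single (α, β')] at h
  · simpa [hκ, Complex.cpow_eq_zero_iff, hq] using h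
  · rintro ⟨c₁, c₂⟩ hc
    by_cases h₁ : c₁ = α
    · by_cases h₂ : c₂ = β'
      · exact absurd (by rw [h₁, h₂]) hc
      · simp [h₂]
    · simp [h₁]

/-- The term with `X` on the second factor stays in v_α ⊗ 𝐕, where Ř is already known to vanish.
Only X v_α ⊗ v_β is left. -/
theorem ColZero.fst (hq : q ≠ 0) {D : Matrix (Lab n) (Lab n) ℂ}
    (hR : Intertwines 1 D X (qPow q (-1) H) R) {α α' β : Lab n}
    {κ : ℂ} (hκ : κ ≠ 0) (hα : ∀ c, X c α = κ * if c = α' then 1 else 0)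
    (hD : D.IsDiag) (hz : ∀ c, ColZero R (α, c)) :
    ColZero R (α', β) := by
  intro a'
  have h := hR.sum_eq_zero (hz β) a'
  have hD' : ∀ c : Lab n × Lab n, check R a' c * (D c.1 α * X c.2 β) = 0 := by
    rintro ⟨c₁, c₂⟩
    by_cases h₁ : c₁ = α
    · rw [h₁, hz, zero_mul]
    · rw [hD h₁]
      simp
  simp only [mul_add, hD', zero_add, one_mul, hα, qPow, Matrix.diagonal_apply] at h
  rw [Fintype.sum_eq_single (α', β)] at h
  · simpa [hκ, Complex.cpow_eq_zero_iff, hq] using h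
  · rintro ⟨c₁, c₂⟩ hc
    by_cases h₁ : c₁ = α'
    · by_cases h₂ : c₂ = β
      · exact absurd (by rw [h₁, h₂]) hc
      · simp [h₂]
    · simp [h₁]

end Uniqueness

/-! ### Generating all labels by Chevalley generators from the highest weight labels. -/

section Generation

variable {m : ℕ}

/-- The effect of `X⁺₀` on labels. -/
def ZeroMove (T : AffineType) (β β' : Lab (m + 1)) : Prop :=
  match T with
  | .D2 => Change₁ 0 0 1 β β'
  | _ => Change₂ 0 0 0 1 1 β β'

/-- The effect of `X⁺_n` on labels. -/
def LastRaise (T : AffineType) (β β' : Lab (m + 1)) : Prop :=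
  match T with
  | .D1 => Change₂ (m - 1) 1 1 0 0 β β'
  | _ => Change₁ m 1 0 β β'

/-- The effect of `X⁻_n` on labels. -/
def LastLower (T : AffineType) (β β' : Lab (m + 1)) : Prop :=
  match T with
  | .D1 => Change₂ (m - 1) 0 0 1 1 β β'
  | _ => Change₁ m 0 1 β β'

theorem even_weight_ends {m : ℕ} (hm : 1 ≤ m) :
    Even (weight fun j : Fin (m + 1) => if (j : ℕ) = 0 ∨ (j : ℕ) = m then (1 : Fin 2) else 0) := by
  obtain ⟨m, rfl⟩ : ∃ k, m = k + 1 := ⟨m - 1, by omega⟩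
  rw [weight, Fin.sum_univ_succ, Fin.sum_univ_castSucc]
  have : ∀ i : Fin m, (i : ℕ) ≠ m := fun i => i.isLt.ne
  simp [this]

/-- Every label is generated by `X⁺₀, …, X⁺_n`. -/
theorem forall_lab_of_raise {T : AffineType} (hm : minRank T ≤ m + 1) (S : Lab (m + 1) → Prop)
    (hmove : ∀ i, i < m → ∀ β β', Change₂ i 1 0 0 1 β β' → S β → S β')
    (hzero : ∀ β β', ZeroMove T β β' → S β → S β')
    (hlast : ∀ β β', LastRaise T β β' → S β → S β')
    (h₀ : S 0) (h₁ : T = .D1 → S (lastLab _ 1)) (β : Lab (m + 1)) : S β := by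
  have finish : (0 < m → ∀ β β', Change₂ 0 0 0 1 1 β β' → S β → S β') → S (firstLab _) → S β := by
    intro hins hf
    rcases Nat.even_or_odd (weight β) with hβ | hβ
    · exact (forall_lab_of_moves S hmove hins).1 h₀ β hβ
    · exact (forall_lab_of_moves S hmove hins).2 hf β hβ
  cases T
  · have hm' : 1 ≤ m := by simp only [minRank] at hm; omega
    -- The odd starting label comes from the even label with 1s at both ends, after X⁺_n removes the
    -- last one.
    refine finish (fun _ => hzero) (hlast _ _ (fun j => ?_)
      ((forall_lab_of_moves S hmove fun _ => hzero).1 h₀ _ (even_weight_ends hm')))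
    by_cases hj : (j : ℕ) = m <;> simp [firstLab, hj]
    omega
  · refine finish (fun hm' β β' hβ hS => ?_) (hzero 0 _ (fun j => ?_) h₀)
    -- A pair 11 is created at the left end in three steps: 00 → 10 → 01 → 11.
    · refine hzero (fun j => if (j : ℕ) = 0 then 0 else β' j) _ (fun j => ?_)
        (hmove 0 hm' (fun j => if (j : ℕ) = 0 then 1 else β j) _ (fun j => ?_)
          (hzero β _ (fun j => ?_) hS))
      · have := hβ j
        by_cases hj : (j : ℕ) = 0 <;> simp [hj] at this ⊢
        exact this.2
      · have := hβ j
        by_cases hj : (j : ℕ) = 0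
        · simp [hj]
        · by_cases hj' : (j : ℕ) = 1 <;> simp [hj, hj'] at this ⊢ <;> exact this
      · have := hβ j
        by_cases hj : (j : ℕ) = 0 <;> simp [hj] at this ⊢
        exact this.1
    · by_cases hj : (j : ℕ) = 0 <;> simp [firstLab, hj]
  · obtain ⟨k, rfl⟩ : ∃ k, m = k + 1 := ⟨m - 1, by simp only [minRank] at hm; omega⟩
    have hk : 1 ≤ k := by simp only [minRank] at hm; omega
    -- The label with 1s at 0, k and k + 1 is reached from (0, …, 0, 1), and X⁺_n then removes the
    -- pair at k, k + 1. That 0 and k are distinct uses n ≥ 3.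
    refine finish (fun _ => hzero) (hlast (Fin.snoc (fun j : Fin (k + 1) =>
      if (j : ℕ) = 0 ∨ (j : ℕ) = k then (1 : Fin 2) else 0) (1 : Fin 2) : Lab (k + 2)) _
        (fun j => ?_) ?_)
    · induction j using Fin.lastCases with
      | last => simp [firstLab]
      | cast j =>
        by_cases hj : (j : ℕ) = k <;> simp [firstLab, hj, j.isLt.ne]
        omega
    · refine (forall_lab_of_moves (fun γ : Lab (k + 1) => S (Fin.snoc γ (1 : Fin 2) : Lab (k + 2)))
        (fun i hi β β' hβ => hmove i (by omega) _ _ (hβ.snoc (by omega) _))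
        (fun hk β β' hβ => hzero _ _ (hβ.snoc (by omega) _))).1 ?_ _ (even_weight_ends hk)
      convert h₁ rfl
      funext j
      induction j using Fin.lastCases with
      | last => simp [lastLab]
      | cast j => simp [lastLab, j.isLt.ne]

/-- Every label is generated by `X⁻₁, …, X⁻_n`. -/
theorem forall_lab_of_lower {T : AffineType} (S : Lab (m + 1) → Prop)
    (hmove : ∀ i, i < m → ∀ β β', Change₂ i 0 1 1 0 β β' → S β → S β')
    (hlast : ∀ β β', LastLower T β β' → S β → S β')
    (h₀ : S 0) (h₁ : T = .D1 → S (lastLab _ 1)) (β : Lab (m + 1)) : S β := by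
  have finish : (0 < m → ∀ β β', Change₂ (m - 1) 0 0 1 1 β β' → S β → S β') →
      S (lastLab _ 1) → S β := by
    intro hins hf
    rcases Nat.even_or_odd (weight β) with hβ | hβ
    · exact (forall_lab_of_moves_rev S hmove hins).1 h₀ β hβ
    · exact (forall_lab_of_moves_rev S hmove hins).2 hf β hβ
  have single : (∀ β β', Change₁ m 0 1 β β' → S β → S β') → S β := by
    intro hl
    refine finish (fun hm' β β' hβ hS => ?_) (hl 0 _ (fun j => ?_) h₀)
    -- The mirrored creation of a pair: 00 → 01 → 10 → 11.
    · refine hl (fun j => if (j : ℕ) = m then 0 else β' j) _ (fun j => ?_)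
        (hmove (m - 1) (by omega) (fun j => if (j : ℕ) = m then 1 else β j) _ (fun j => ?_)
          (hl β _ (fun j => ?_) hS))
      · have := hβ j
        by_cases hj : (j : ℕ) = m
        · simp [hj, show m ≠ m - 1 by omega, show m - 1 + 1 = m by omega] at this ⊢
          exact this.2
        · simp [hj]
      · have := hβ j
        by_cases hj : (j : ℕ) = m
        · simp [hj, show m ≠ m - 1 by omega, show m - 1 + 1 = m by omega]
        · by_cases hj' : (j : ℕ) = m - 1
          · simp [hj', show m - 1 ≠ m by omega] at this ⊢
            exact this
          · simp [hj, hj', show m - 1 + 1 = m by omega] at this ⊢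
            exact this
      · have := hβ j
        by_cases hj : (j : ℕ) = m
        · simp [hj, show m ≠ m - 1 by omega, show m - 1 + 1 = m by omega] at this ⊢
          exact this.1
        · simp [hj]
    · by_cases hj : (j : ℕ) = m <;> simp [lastLab, hj]
  cases T
  · exact single hlast
  · exact single hlast
  · exact finish (fun _ => hlast) (h₁ rfl)

end Generation

/-! ### Vanishing of intertwiners at spectral parameter zero. -/

section Uniqueness

variable {m : ℕ} {R : Matrix (Lab (m + 1) × Lab (m + 1)) (Lab (m + 1) × Lab (m + 1)) ℂ} {q : ℂ}
  {T : AffineType}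

theorem Xp_col (c : Fin 2) : Xp c 1 = if c = 0 then 1 else 0 := by
  fin_cases c <;> simp [Xp]

theorem Xm_col (c : Fin 2) : Xm c 0 = if c = 1 then 1 else 0 := by
  fin_cases c <;> simp [Xm]

theorem Xp_col_zero (c : Fin 2) : Xp c 0 = 0 := by
  fin_cases c <;> simp [Xp]

/-- The scalar that `X_i^±` produces when moving between labels. -/
theorem exists_chevX_zero_apply (hq : csqrt (q + q⁻¹) ≠ 0) {β β' : Lab (m + 1)}
    (hβ : ZeroMove T β β') :
    ∃ κ ≠ 0, ∀ c, chevX T (m + 1) q 0 c β = κ * if c = β' then 1 else 0 := by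
  cases T
  · refine ⟨-1, by simp, fun c => ?_⟩
    simp only [chevX, if_true, Matrix.neg_apply, site₂_apply_of_change Xm_col Xm_col hβ]
    ring
  · refine ⟨-(csqrt (q + q⁻¹))⁻¹, by simp [hq], fun c => ?_⟩
    simp only [chevX, if_true, Matrix.neg_apply, Matrix.smul_apply, smul_eq_mul,
      site_apply_of_change Xm_col hβ]
    ring
  · refine ⟨-1, by simp, fun c => ?_⟩
    simp only [chevX, if_true, Matrix.neg_apply, site₂_apply_of_change Xm_col Xm_col hβ]
    ring

theorem exists_chevX_last_apply (hm : minRank T ≤ m + 1) (hq : csqrt (q + q⁻¹) ≠ 0)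
    {β β' : Lab (m + 1)} (hβ : LastRaise T β β') :
    ∃ κ ≠ 0, ∀ c, chevX T (m + 1) q (m + 1) c β = κ * if c = β' then 1 else 0 := by
  have h0 : m + 1 ≠ 0 := by omega
  cases T
  · refine ⟨(csqrt (q + q⁻¹))⁻¹, by simp [hq], fun c => ?_⟩
    simp only [chevX, h0, lt_irrefl, if_false, Matrix.smul_apply, smul_eq_mul,
      site_apply_of_change Xp_col hβ]
  · refine ⟨(csqrt (q + q⁻¹))⁻¹, by simp [hq], fun c => ?_⟩
    simp only [chevX, h0, lt_irrefl, if_false, Matrix.smul_apply, smul_eq_mul,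
      site_apply_of_change Xp_col hβ]
  · obtain ⟨k, rfl⟩ : ∃ k, m = k + 1 := ⟨m - 1, by simp only [minRank] at hm; omega⟩
    have hβ' : Change₂ k 1 1 0 0 β β' := hβ
    refine ⟨-1, by simp, fun c => ?_⟩
    simp only [chevX, h0, lt_irrefl, if_false, Matrix.neg_apply, Nat.add_sub_cancel,
      site₂_apply_of_change Xp_col Xp_col hβ']
    ring

theorem exists_chevX_last_transpose_apply (hm : minRank T ≤ m + 1) (hq : csqrt (q + q⁻¹) ≠ 0)
    {β β' : Lab (m + 1)} (hβ : LastLower T β β') :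
    ∃ κ ≠ 0, ∀ c, (chevX T (m + 1) q (m + 1)).transpose c β = κ * if c = β' then 1 else 0 := by
  have h0 : m + 1 ≠ 0 := by omega
  cases T
  · refine ⟨(csqrt (q + q⁻¹))⁻¹, by simp [hq], fun c => ?_⟩
    simp only [chevX, h0, lt_irrefl, if_false, Matrix.transpose_smul, transpose_site, transpose_Xp,
      Matrix.smul_apply, smul_eq_mul, site_apply_of_change Xm_col hβ]
  · refine ⟨(csqrt (q + q⁻¹))⁻¹, by simp [hq], fun c => ?_⟩
    simp only [chevX, h0, lt_irrefl, if_false, Matrix.transpose_smul, transpose_site, transpose_Xp,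
      Matrix.smul_apply, smul_eq_mul, site_apply_of_change Xm_col hβ]
  · obtain ⟨k, rfl⟩ : ∃ k, m = k + 1 := ⟨m - 1, by simp only [minRank] at hm; omega⟩
    have hβ' : Change₂ k 0 0 1 1 β β' := hβ
    refine ⟨-1, by simp, fun c => ?_⟩
    simp only [chevX, h0, lt_irrefl, if_false, Matrix.transpose_neg, transpose_site₂, transpose_Xp,
      Matrix.neg_apply, Nat.add_sub_cancel, site₂_apply_of_change Xm_col Xm_col hβ']
    ring

theorem chevX_mid_apply {i : ℕ} (hi : i < m) {β β' : Lab (m + 1)}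
    (hβ : Change₂ i 1 0 0 1 β β') (c : Lab (m + 1)) :
    chevX T (m + 1) q (i + 1) c β = -1 * if c = β' then 1 else 0 := by
  simp only [chevX, Nat.succ_ne_zero, Nat.add_lt_add_iff_right, hi, if_false, if_true,
    Matrix.neg_apply, site₂_apply_of_change Xp_col Xm_col hβ]
  ring

theorem chevX_mid_transpose_apply {i : ℕ} (hi : i < m) {β β' : Lab (m + 1)}
    (hβ : Change₂ i 0 1 1 0 β β') (c : Lab (m + 1)) :
    (chevX T (m + 1) q (i + 1)).transpose c β = -1 * if c = β' then 1 else 0 := by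
  simp only [chevX, Nat.succ_ne_zero, Nat.add_lt_add_iff_right, hi, if_false, if_true,
    Matrix.transpose_neg, transpose_site₂, transpose_Xp, transpose_Xm, Matrix.neg_apply,
    site₂_apply_of_change Xm_col Xp_col hβ]
  ring

/-- The label `(0, …, 0, α)`, with `α = 0` unless the type is `D^{(1)}_n`, is of highest weight. -/
theorem chevX_apply_lastLab (hm : minRank T ≤ m + 1) {α : Fin 2} (hα : T ≠ .D1 → α = 0) {i : ℕ}
    (hi : i < m + 1) (c : Lab (m + 1)) : chevX T (m + 1) q (i + 1) c (lastLab _ α) = 0 := by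
  rcases Nat.lt_succ_iff_lt_or_eq.mp hi with hi' | rfl
  · simp only [chevX, Nat.succ_ne_zero, Nat.add_lt_add_iff_right, hi', if_false, if_true,
      Matrix.neg_apply]
    rw [site₂_apply_eq_zero ⟨i, hi⟩ (by simp [lastLab, hi'.ne, Xp_col_zero]), neg_zero]
  · simp only [chevX, Nat.succ_ne_zero, lt_irrefl, if_false]
    cases T
    · change ((csqrt (q + q⁻¹))⁻¹ • site (i + 1) (i + 1) Xp) c _ = 0
      rw [hα (by simp), Matrix.smul_apply, site_apply_eq_zero ⟨i, hi⟩ (by simp [lastLab, Xp_col_zero]),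
        smul_zero]
    · change ((csqrt (q + q⁻¹))⁻¹ • site (i + 1) (i + 1) Xp) c _ = 0
      rw [hα (by simp), Matrix.smul_apply, site_apply_eq_zero ⟨i, hi⟩ (by simp [lastLab, Xp_col_zero]),
        smul_zero]
    · obtain ⟨k, rfl⟩ : ∃ k, i = k + 1 := ⟨i - 1, by simp only [minRank] at hm; omega⟩
      simp only [Matrix.neg_apply, Nat.add_sub_cancel]
      rw [site₂_apply_eq_zero ⟨k, by omega⟩ (by simp [lastLab, Xp_col_zero]), neg_zero]

/-- The H_i with i ≥ 1 span all one-site operators: start from the last site and add differences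
while descending. For D^{(1)}_n the last site is half of H_n - H_{n-1}. -/
theorem preservesWeight_site_of_isIntertwiner (hm : minRank T ≤ m + 1)
    (hR : IsIntertwiner T (m + 1) q (0 : ℂ) R) (k : Fin (m + 1)) :
    PreservesWeight (site (m + 1) (k + 1) Hm) R := by
  have hlast : PreservesWeight (site (m + 1) (m + 1) Hm) R := by
    have h := hR.comm_H (m + 1) (by omega) le_rfl
    simp only [chevH, Nat.succ_ne_zero, lt_irrefl, if_false] at h
    cases T
    · exact h
    · exact h
    · obtain ⟨l, rfl⟩ : ∃ l, m = l + 1 := ⟨m - 1, by simp only [minRank] at hm; omega⟩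
      have h' := hR.comm_H (l + 1) (by omega) (by omega)
      simp only [chevH, Nat.succ_ne_zero, Nat.lt_succ_self, if_false, if_true] at h'
      have := (h.add h'.neg).smul (1 / 2)
      convert this using 1
      simp only [Nat.add_sub_cancel]
      module
  have key : ∀ d, d ≤ m → PreservesWeight (site (m + 1) (m - d + 1) Hm) R := by
    intro d hd
    induction d with
    | zero => exact hlast
    | succ d ih =>
      have h := hR.comm_H (m - (d + 1) + 1) (by omega) (by omega)
      simp only [chevH, Nat.succ_ne_zero, if_false,
        show m - (d + 1) + 1 < m + 1 by omega, if_true] at h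
      have := h.add (ih (by omega))
      rwa [show m - (d + 1) + 1 + 1 = m - d + 1 by omega, sub_add_cancel] at this
  have := key (m - k) (by omega)
  rwa [show m - (m - (k : ℕ)) = k by omega] at this

theorem Hm_add_eq_one (a b : Fin 2) (hab : Hm a a + Hm b b = 1) : a = 0 ∧ b = 0 := by
  fin_cases a <;> fin_cases b <;> first | exact ⟨rfl, rfl⟩ | norm_num [Hm] at hab

/-- Columns of `Ř` at products of highest weight vectors vanish. -/
theorem colZero_lastLab (hm : minRank T ≤ m + 1) (hR : IsIntertwiner T (m + 1) q (0 : ℂ) R)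
    (hN : NormalizedAt T R 0) {α β : Fin 2} (hα : T ≠ .D1 → α = 0) (hβ : T ≠ .D1 → β = 0) :
    ColZero R (lastLab _ α, lastLab _ β) := by
  rintro ⟨a, b⟩
  by_contra hne
  have hw : ∀ k, pairWeight k (a, b) = pairWeight k (lastLab (m + 1) α, lastLab (m + 1) β) := by
    intro k
    have := (preservesWeight_site_iff k R).mp (preservesWeight_site_of_isIntertwiner hm hR k) (a, b)
      (lastLab _ α, lastLab _ β)
    rw [mul_comm] at this
    exact (mul_right_cancel₀ hne this).symm
  have hab : ∀ k : Fin (m + 1), lastLab (m + 1) α k = 0 → lastLab (m + 1) β k = 0 →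
      a k = 0 ∧ b k = 0 := by
    intro k h₁ h₂
    refine Hm_add_eq_one _ _ ((hw k).trans ?_)
    change Hm (lastLab (m + 1) α k) (lastLab (m + 1) α k) +
      Hm (lastLab (m + 1) β k) (lastLab (m + 1) β k) = 1
    rw [h₁, h₂]
    norm_num [Hm]
  by_cases hT : T = .D1
  · subst hT
    obtain ⟨hP, hN⟩ := hN
    have hk : ∀ k : Fin (m + 1), (k : ℕ) ≠ m → a k = 0 ∧ b k = 0 := fun k hk =>
      hab k (by simp [lastLab, hk]) (by simp [lastLab, hk])
    have hl : ∀ c : Lab (m + 1), (∀ k : Fin (m + 1), (k : ℕ) ≠ m → c k = 0) →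
        c = lastLab _ (c (Fin.last m)) := by
      intro c hc
      funext k
      induction k using Fin.lastCases with
      | last => simp [lastLab]
      | cast k => simp [lastLab, hc k.castSucc (by simpa using k.isLt.ne), k.isLt.ne]
    have hpar : ∀ c d : Fin 2, c ≠ d → parity (lastLab (m + 1) c) ≠ parity (lastLab (m + 1) d) := by
      have : ∀ c : Fin 2, parity (lastLab (m + 1) c) = (-1) ^ (c : ℕ) := by
        intro c
        have : ∀ i : Fin m, (i : ℕ) ≠ m := fun i => i.isLt.ne
        simp [parity, Fin.sum_univ_castSucc, lastLab, this]
      simp only [this]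
      decide
    apply hne
    change R (b, a) _ = 0
    rw [hl a fun k h => (hk k h).1, hl b fun k h => (hk k h).2]
    -- Weight conservation alone would still allow other last entries; parity excludes them, and the
    -- normalization gives 0 on the remaining diagonal entry.
    by_cases h₁ : b (Fin.last m) = α
    · by_cases h₂ : a (Fin.last m) = β
      · rw [h₁, h₂]
        exact hN α β
      · exact hP _ _ (.inr (hpar _ _ h₂))
    · exact hP _ _ (.inl (hpar _ _ h₁))
  · have h0 : lastLab (m + 1) 0 = 0 := by
      funext k
      simp [lastLab]
    rw [hα hT, hβ hT, h0] at hab hne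
    have ha : a = 0 := funext fun k => (hab k rfl rfl).1
    have hb : b = 0 := funext fun k => (hab k rfl rfl).2
    apply hne
    rw [ha, hb]
    change R (0, 0) (0, 0) = 0
    cases T
    · exact hN
    · exact hN
    · exact absurd rfl hT

/-- At spectral parameter zero an intertwiner is determined by its normalization. -/
theorem eq_zero_of_isIntertwiner_zero (hm : minRank T ≤ m + 1) (hq : q ≠ 0)
    (hq' : csqrt (q + q⁻¹) ≠ 0) (hR : IsIntertwiner T (m + 1) q (0 : ℂ) R)
    (hN : NormalizedAt T R 0) : R = 0 := by
  have h0 : lastLab (m + 1) 0 = 0 := by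
    funext k
    simp [lastLab]
  have step₁ : ∀ α : Fin 2, (T ≠ .D1 → α = 0) → ∀ β, ColZero R (lastLab _ α, β) := by
    intro α hα
    refine forall_lab_of_raise hm _ (fun i hi β β' hβ hz => ?_) (fun β β' hβ hz => ?_)
      (fun β β' hβ hz => ?_) ?_ ?_
    · exact hz.snd hq (hR.comm_Xp (i + 1) (by omega) (by omega))
        (fun c => by rw [chevX_apply_lastLab hm hα (by omega), mul_zero]) (by simp : (-1 : ℂ) ≠ 0)
        (chevX_mid_apply hi hβ)
    -- At ξ = 0 the term with X⁺₀ on the first factor is absent, so nothing is required of X⁺₀ v_α.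
    · obtain ⟨κ, hκ, h⟩ := exists_chevX_zero_apply hq' hβ
      exact hz.snd hq hR.zero_action (fun c => zero_mul _) hκ h
    · obtain ⟨κ, hκ, h⟩ := exists_chevX_last_apply hm hq' hβ
      exact hz.snd hq (hR.comm_Xp (m + 1) (by omega) le_rfl)
        (fun c => by rw [chevX_apply_lastLab hm hα (by omega), mul_zero]) hκ h
    · rw [← h0]
      exact colZero_lastLab hm hR hN hα fun _ => rfl
    · exact fun hT => colZero_lastLab hm hR hN hα fun h => absurd hT h
  have step₂ : ∀ α, ∀ β, ColZero R (α, β) := by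
    refine forall_lab_of_lower (T := T) _ (fun i hi α α' hα hz β => ?_) (fun α α' hα hz β => ?_)
      ?_ ?_
    · exact ColZero.fst hq (hR.comm_Xm (i + 1) (by omega) (by omega)) (by simp : (-1 : ℂ) ≠ 0)
        (chevX_mid_transpose_apply hi hα) (Matrix.isDiag_diagonal _) hz
    · obtain ⟨κ, hκ, h⟩ := exists_chevX_last_transpose_apply hm hq' hα
      exact ColZero.fst hq (hR.comm_Xm (m + 1) (by omega) le_rfl) hκ h (Matrix.isDiag_diagonal _) hz
    · rw [← h0]
      exact step₁ 0 fun _ => rfl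
    · exact fun hT => step₁ 1 fun h => absurd hT h
  ext a' a
  have := step₂ a.1 a.2 a'.swap
  rwa [check, Matrix.submatrix_apply, Prod.swap_swap] at this

end Uniqueness

/-! ## Descent from Laurent series to rational functions -/

section Descent

open scoped RatFunc

/-- Laurent series as a complex algebra, with coefficientwise scalar multiplication. -/
local instance laurentAlgebra : Algebra ℂ (LaurentSeries ℂ) := HahnSeries.instAlgebra

/-- Constants have the same meaning along both routes, which makes the expansion and the retraction
ℂ-linear as `Intertwines.map` requires. -/
theorem algebraMap_ratFunc_algebraMap (c : ℂ) :
    algebraMap (RatFunc ℂ) (LaurentSeries ℂ) (algebraMap ℂ (RatFunc ℂ) c) =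
      algebraMap ℂ (LaurentSeries ℂ) c := by
  rw [IsScalarTower.algebraMap_apply ℂ (Polynomial ℂ) (RatFunc ℂ),
    ← IsScalarTower.algebraMap_apply (Polynomial ℂ) (RatFunc ℂ) (LaurentSeries ℂ)]
  simp [HahnSeries.algebraMap_apply]

/-- The expansion at `0` of rational functions, as a complex linear map. -/
def expansion : RatFunc ℂ →ₗ[ℂ] LaurentSeries ℂ where
  toFun := algebraMap (RatFunc ℂ) (LaurentSeries ℂ)
  map_add' := map_add _
  map_smul' c f := by
    rw [Algebra.smul_def, map_mul, algebraMap_ratFunc_algebraMap, RingHom.id_apply,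
      ← Algebra.smul_def]

/-- A linear map over the rational functions is complex linear. -/
def restrictComplex (π : LaurentSeries ℂ →ₗ[RatFunc ℂ] RatFunc ℂ) :
    LaurentSeries ℂ →ₗ[ℂ] RatFunc ℂ where
  toFun := π
  map_add' := map_add π
  map_smul' c f := by
    rw [Algebra.smul_def c f, ← algebraMap_ratFunc_algebraMap, ← Algebra.smul_def, map_smul,
      smul_eq_mul, RingHom.id_apply, ← Algebra.smul_def]

theorem expansion_X_mul (f : RatFunc ℂ) :
    expansion (RatFunc.X * f) = HahnSeries.single 1 1 * expansion f := by
  have := map_mul (algebraMap (RatFunc ℂ) (LaurentSeries ℂ)) RatFunc.X f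
  rwa [RatFunc.coe_X] at this

theorem restrictComplex_single_mul (π : LaurentSeries ℂ →ₗ[RatFunc ℂ] RatFunc ℂ)
    (f : LaurentSeries ℂ) :
    restrictComplex π (HahnSeries.single 1 1 * f) = RatFunc.X * restrictComplex π f := by
  have := map_smul π RatFunc.X f
  rwa [Algebra.smul_def, RatFunc.coe_X] at this

theorem NormalizedAt.map {n : ℕ} {K K' : Type} [Zero K] [Zero K'] {T : AffineType}
    {R : Matrix (Lab n × Lab n) (Lab n × Lab n) K} {c : K} (hR : NormalizedAt T R c) (φ : K → K')
    (hφ : φ 0 = 0) : NormalizedAt T (R.map φ) (φ c) := by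
  cases T
  · exact congrArg φ hR
  · exact congrArg φ hR
  · exact ⟨fun a' a h => (congrArg φ (hR.1 a' a h)).trans hφ, fun α β => congrArg φ (hR.2 α β)⟩

theorem NormalizedAt.sub {n : ℕ} {K : Type} [AddGroup K] {T : AffineType}
    {R S : Matrix (Lab n × Lab n) (Lab n × Lab n) K} {c d : K} (hR : NormalizedAt T R c)
    (hS : NormalizedAt T S d) : NormalizedAt T (R - S) (c - d) := by
  cases T
  · exact congrArg₂ _ hR hS
  · exact congrArg₂ _ hR hS
  · refine ⟨fun a' a h => ?_, fun α β => congrArg₂ _ (hR.2 α β) (hS.2 α β)⟩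
    rw [Matrix.sub_apply, hR.1 a' a h, hS.1 a' a h, sub_zero]

theorem normalized_iff {n : ℕ} {T : AffineType}
    {R : Matrix (Lab n × Lab n) (Lab n × Lab n) (RatFunc ℂ)} :
    Normalized T R ↔ NormalizedAt T R 1 := by
  cases T <;> rfl

theorem exists_forall_coeff_eq_zero {ι : Type} [Finite ι] (f : ι → LaurentSeries ℂ) :
    ∃ N : ℤ, ∀ i, ∀ k < N, (f i).coeff k = 0 := by
  obtain ⟨N, hN⟩ := (Set.finite_range fun i => (f i).order).bddBelow
  exact ⟨N, fun i k hk => HahnSeries.coeff_eq_zero_of_lt_order (hk.trans_le (hN ⟨i, rfl⟩))⟩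

/-- Over Laurent series an intertwiner is determined by its normalization, because its lowest
coefficient is an intertwiner at spectral parameter zero. -/
theorem eq_zero_of_isIntertwiner_laurent {T : AffineType} {m : ℕ} {q : ℂ} (hm : minRank T ≤ m + 1)
    (hq : q ≠ 0) (hq' : csqrt (q + q⁻¹) ≠ 0)
    {R : Matrix (Lab (m + 1) × Lab (m + 1)) (Lab (m + 1) × Lab (m + 1)) (LaurentSeries ℂ)}
    (hR : IsIntertwiner T (m + 1) q (HahnSeries.single 1 1 : LaurentSeries ℂ) R)
    (hN : NormalizedAt T R 0) : R = 0 := by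
  obtain ⟨N, hz⟩ := exists_forall_coeff_eq_zero
    fun ab : (Lab (m + 1) × Lab (m + 1)) × (Lab (m + 1) × Lab (m + 1)) => R ab.1 ab.2
  have key : ∀ d : ℕ, ∀ k, k < N + d → ∀ a b, (R a b).coeff k = 0 := by
    intro d
    induction d with
    | zero => exact fun k hk a b => hz (a, b) k (by simpa using hk)
    | succ d ih =>
      intro k hk a b
      rcases (show k ≤ N + d by push_cast at hk; omega).lt_or_eq with hk' | rfl
      · exact ih k hk' a b
      -- Multiplication by x brings into degree N + d only the coefficient of degree N + d - 1,
      -- already known to vanish; hence the spectral parameter becomes 0.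
      · let φ : LaurentSeries ℂ →ₗ[ℂ] ℂ := HahnSeries.coeff.linearMap (N + d)
        have h₁ : IsIntertwiner T (m + 1) q (0 : ℂ) (R.map φ) := by
          refine hR.map φ fun a b => ?_
          rw [zero_mul]
          change (HahnSeries.single 1 1 * R a b).coeff (N + d) = 0
          rw [HahnSeries.coeff_single_mul, ih _ (by omega), mul_zero]
        have h₂ := eq_zero_of_isIntertwiner_zero hm hq hq' h₁
          (by simpa using hN.map φ (map_zero φ))
        exact congrFun (congrFun h₂ a) b
  ext a b k
  exact key (k - N + 1).toNat k (by omega) a b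

/-- Existence and uniqueness of the quantum `R` matrix, and its expansion. -/
theorem existsUnique_isQuantumR {T : AffineType} {n : ℕ} {q h : ℂ} (hn : minRank T ≤ n)
    (hq : q ≠ 0) (hroot : ∀ m : ℕ, 0 < m → q ^ m ≠ 1) (hh : h ≠ 0) (hpq : h = Complex.I * q) :
    (∃! R, IsQuantumR T n q R) ∧ ∀ R, IsQuantumR T n q R → Agrees R (calR T n h hh) := by
  have hn₁ : 1 ≤ n := by cases T <;> simp only [minRank] at hn <;> omega
  obtain ⟨m, rfl⟩ : ∃ m, n = m + 1 := ⟨n - 1, by omega⟩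
  -- Otherwise q² = -1, and q would be a fourth root of unity.
  have hq' : csqrt (q + q⁻¹) ≠ 0 := by
    intro h0
    have h1 := csqrt_mul_self (q + q⁻¹)
    rw [h0, zero_mul] at h1
    field_simp at h1
    exact hroot 4 (by norm_num) (by linear_combination (q ^ 2 - 1) * h1.symm)
  have hp : ∀ k : ℕ, 0 < k → (h ^ 2) ^ k ≠ 1 := by
    intro k hk h1
    -- Since p = -q², p^k = 1 forces q^{4k} = 1.
    refine hroot (4 * k) (by omega) ?_
    have : q ^ 4 = (h ^ 2) ^ 2 := by
      rw [hpq, mul_pow, Complex.I_sq]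
      ring
    rw [pow_mul, this, pow_right_comm, h1, one_pow]
  set S : Matrix (Lab (m + 1) × Lab (m + 1)) (Lab (m + 1) × Lab (m + 1)) (LaurentSeries ℂ) :=
    (calR T (m + 1) h hh).map (HahnSeries.ofPowerSeries ℤ ℂ) with hS
  have hSi : IsIntertwiner T (m + 1) q (HahnSeries.single 1 1 : LaurentSeries ℂ) S := by
    have h₁ := layerR_isIntertwiner (boundary_bracketLin hh hp T) hn hh hq hpq
    rw [← calR_eq_layerR] at h₁
    refine h₁.map (HahnSeries.ofPowerSeriesAlg ℤ ℂ (A := ℂ)).toLinearMap fun a b => ?_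
    change HahnSeries.ofPowerSeries ℤ ℂ _ = _ * HahnSeries.ofPowerSeries ℤ ℂ _
    rw [map_mul, HahnSeries.ofPowerSeries_X]
  have hSn : NormalizedAt T S 1 := by
    have := (calR_normalizedAt hh (T := T) (n := m + 1) hn₁).map (HahnSeries.ofPowerSeries ℤ ℂ)
      (map_zero _)
    rwa [map_one] at this
  have huniq : ∀ S', IsIntertwiner T (m + 1) q (HahnSeries.single 1 1 : LaurentSeries ℂ) S' →
      NormalizedAt T S' 1 → S' = S := by
    intro S' h₁ h₂
    have := h₂.sub hSn
    rw [sub_self] at this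
    exact sub_eq_zero.mp (eq_zero_of_isIntertwiner_laurent hn hq hq' (h₁.sub hSi) this)
  have hagree : ∀ R, IsQuantumR T (m + 1) q R →
      R.map (algebraMap (RatFunc ℂ) (LaurentSeries ℂ)) = S := by
    intro R hR
    rw [isQuantumR_iff, normalized_iff] at hR
    refine huniq _ ?_ ?_
    · exact hR.1.map expansion fun a b => expansion_X_mul _
    · have := hR.2.map (algebraMap (RatFunc ℂ) (LaurentSeries ℂ)) (map_zero _)
      rwa [map_one] at this
  refine ⟨?_, hagree⟩
  -- Any ℂ(x)-linear retraction serves: the equations have coefficients in ℂ(x), and π(1) = 1 keeps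
  -- the normalization.
  obtain ⟨π, hπ⟩ := LinearMap.exists_leftInverse_of_injective
    (Algebra.linearMap (RatFunc ℂ) (LaurentSeries ℂ))
    (LinearMap.ker_eq_bot.mpr (algebraMap (RatFunc ℂ) (LaurentSeries ℂ)).injective)
  refine ⟨S.map π, ?_, fun R hR => ?_⟩
  · change IsQuantumR T (m + 1) q (S.map π)
    rw [isQuantumR_iff, normalized_iff]
    constructor
    · exact hSi.map (restrictComplex π) fun a b => restrictComplex_single_mul π _
    · have := hSn.map π (map_zero π)
      have h1 : π 1 = 1 := by simpa using LinearMap.congr_fun hπ 1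
      rwa [h1] at this
  -- A rational solution expands to `S`, and π recovers it from its expansion.
  · rw [← hagree R hR]
    ext a b
    exact (LinearMap.congr_fun hπ (R a b)).symm

end Descent

end

end SpinR

theorem theorem6p1 (q h : ℂ) (hq : q ≠ 0) (hroot : ∀ m : ℕ, 0 < m → q ^ m ≠ 1)
    (hh : h ≠ 0) (hpq : h = Complex.I * q) :
    (∀ n : ℕ, 2 ≤ n →
      (∃! R, SpinR.IsQuantumR .B1 n q R) ∧
      ∀ R, SpinR.IsQuantumR .B1 n q R → SpinR.Agrees R (SpinR.calR .B1 n h hh)) ∧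
    (∀ n : ℕ, 1 ≤ n →
      (∃! R, SpinR.IsQuantumR .D2 n q R) ∧
      ∀ R, SpinR.IsQuantumR .D2 n q R → SpinR.Agrees R (SpinR.calR .D2 n h hh)) ∧
    (∀ n : ℕ, 3 ≤ n →
      (∃! R, SpinR.IsQuantumR .D1 n q R) ∧
      ∀ R, SpinR.IsQuantumR .D1 n q R → SpinR.Agrees R (SpinR.calR .D1 n h hh)) :=
  ⟨fun _ hn => SpinR.existsUnique_isQuantumR hn hq hroot hh hpq,
    fun _ hn => SpinR.existsUnique_isQuantumR hn hq hroot hh hpq,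
    fun _ hn => SpinR.existsUnique_isQuantumR hn hq hroot hh hpq⟩
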